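/- Let $d\ge 1$ and let $k_1\ge k_2\ge\dots\ge k_d\ge 3$ be integers. Let $T^{(d)}_{k_1,\dots,k_d}=R_{k_1}\times\cdots\times R_{k_d}$ be the $d$-dimensional torus, i.e. the Cartesian product of the rings (cycles) $R_{k_i}$ on $k_i$ vertices; two vertices of the product are adjacent if and only if they are adjacent in one coordinate and equal in all the others. For a finite graph $G$ with $n$ vertices let the bisection width $BW(G)$ be the minimum, over all sets $S\subseteq V(G)$ with $|S|=\lfloor n/2\rfloor$, of the number of edges of $G$ with exactly one endpoint in $S$. Then $$BW\bigl(T^{(d)}_{k_1,\dots,k_d}\bigr)=2\sum_{i=1}^{e}C_i,\qquad C_i=\prod_{j=i+1}^{d}k_j,$$ where $e$ is the smallest index $i$ for which $k_i$ is even, and $e=d$ if all $k_i$ are odd. -/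

import Mathlib

/-- The Cartesian (box) product of a family of graphs: two vertices are adjacent iff they are
adjacent in exactly one coordinate and agree in all the others. -/
def cartesianProduct {ι : Type*} {V : ι → Type*} (G : ∀ i, SimpleGraph (V i)) :
    SimpleGraph (∀ i, V i) where
  Adj u v := ∃ i, (G i).Adj (u i) (v i) ∧ ∀ j, j ≠ i → u j = v j
  symm := ⟨fun _ _ ⟨i, h, h'⟩ => ⟨i, h.symm, fun j hj => (h' j hj).symm⟩⟩
  loopless := ⟨fun _ ⟨_, h, _⟩ => h.ne rfl⟩

/-- The `d`-dimensional torus: the Cartesian product of `d` rings with `k 0, …, k (d - 1)`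
vertices. -/
def torus {d : ℕ} (k : Fin d → ℕ) : SimpleGraph (∀ i, Fin (k i)) :=
  cartesianProduct fun i => SimpleGraph.cycleGraph (k i)

open Classical in
/-- The number of edges of `G` between `S` and its complement. Each such edge is counted once, as
the pair of its endpoint in `S` and its endpoint outside `S`. -/
noncomputable def cutSize {V : Type*} [Fintype V] (G : SimpleGraph V) (S : Finset V) : ℕ :=
  (G.interedges S Sᶜ).card

/-- The bisection width of a finite graph with `n` vertices: the minimum number of edges between
`S` and its complement over all vertex sets `S` with `⌊n / 2⌋` elements. -/
noncomputable def bisectionWidth {V : Type*} [Fintype V] (G : SimpleGraph V) : ℕ :=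
  sInf {c | ∃ S : Finset V, S.card = Fintype.card V / 2 ∧ cutSize G S = c}

open Classical in
/-- The lowest dimension, numbered from `1` to `d`, in which the number of vertices is even, and
`d` if there is none. Dimension `i + 1` has `k i` vertices. -/
noncomputable def lowestEvenDim {d : ℕ} (k : Fin d → ℕ) : ℕ :=
  if h : ∃ i : ℕ, ∃ hi : i < d, Even (k ⟨i, hi⟩) then Nat.find h + 1 else d

/-! The torus is compared with a weighted product of complete graphs. Let `cutDir i S` count the
pairs in `S × Sᶜ` that differ in coordinate `i` only, and give direction `i` the weight
`balancedWeight k i = 1 / (⌊k_i/2⌋ ⌈k_i/2⌉)`. A line meeting `S` in `a` points contributes `a (k_i -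
a)` to `cutDir`, at most the reciprocal of the weight, whereas a ring is cut at least twice by a
nonempty proper subset. Summing over lines, the torus cut is at least twice the weighted cut
(`two_mul_weightedCut_le`). For `lexHalf`, the points lexicographically before their reflection in
the centre, each line is empty, full, or cut in an initial interval of about half its length, so
equality holds (`cutSize_lexHalf`).

As `lexHalf` is an initial segment of the lexicographic order, it remains to show that such segments
minimize the weighted cut among sets of equal size (`LexInitial.weightedCut_le`). This is an
induction on the number of directions and on the rank sum. Replacing slices by initial segments
never increases the cut (`exists_compression`). If all slices are already initial and there are at
least three directions, exchanging the last point present for the first one missing does the rest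
(`exists_improving_swap`).

The core is the case of two directions. For a set closed under lowering coordinates, the weighted
cut is a constant minus twice the weighted coordinate sum, so that sum must be maximal for a grid
filled column by column (`weighted_sum_sq_le`). Another lower set loses `G = columnGap` in twice the
second coordinate sum and gains at most `G + 2E`, `E = rowExcess`, in twice the first. The gain is
controlled by the equal-weight theorem in a square (`sum_fst_add_snd_le`), and `E` is bounded by a
multiple of `G` (`residueSq_gap_window`). The resulting condition `w₁ (K² - 1) ≤ w₂ k²` is just what
the balanced weights satisfy. -/

/-! ### The form `residueSq` and sums of quotients and remainders -/

/-- The square form `z ↦ r (k - r)`, where `r` is the residue of `z` modulo `k`. -/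
def residueSq (k z : ℤ) : ℤ := z % k * (k - z % k)

theorem residueSq_eq {k z : ℤ} (m : ℤ) (h0 : 0 ≤ z - m * k) (h1 : z - m * k ≤ k) :
    residueSq k z = (z - m * k) * (k - (z - m * k)) := by
  unfold residueSq
  rcases eq_or_lt_of_le h1 with h | h
  · have hz : z = (m + 1) * k := by linarith
    rw [hz, Int.mul_emod_left]; ring
  · have : z % k = z - m * k := by
      have := Int.add_mul_emod_self_right (z - m * k) m k
      rw [sub_add_cancel, Int.emod_eq_of_lt h0 h] at this
      exact this
    rw [this]

theorem residueSq_of_le {k z : ℤ} (h0 : 0 ≤ z) (h1 : z ≤ k) : residueSq k z = z * (k - z) := by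
  have := residueSq_eq (k := k) (z := z) 0 (by linarith) (by linarith)
  simpa using this

theorem residueSq_add_mul (k z m : ℤ) : residueSq k (z + m * k) = residueSq k z := by
  simp [residueSq]

theorem residueSq_neg {k : ℤ} (hk : 0 < k) (z : ℤ) : residueSq k (-z) = residueSq k z := by
  have h0 := Int.emod_nonneg z hk.ne'
  have h1 := Int.emod_lt_of_pos z hk
  have h2 := Int.emod_add_mul_ediv z k
  rw [residueSq_eq (k := k) (z := -z) (-(z / k) - 1) (by nlinarith) (by nlinarith)]
  have : -z - (-(z / k) - 1) * k = k - z % k := by linarith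
  rw [this]; unfold residueSq; ring

theorem residueSq_abs {k : ℤ} (hk : 0 < k) (z : ℤ) : residueSq k |z| = residueSq k z := by
  rcases abs_choice z with h | h <;> rw [h]
  exact residueSq_neg hk z

theorem four_mul_residueSq_le (k z : ℤ) : 4 * residueSq k z ≤ k ^ 2 := by
  unfold residueSq
  nlinarith [sq_nonneg (k - 2 * (z % k))]

/-- For residues `a`, `b` the loss is `2ab` if `a + b` does not wrap around, and `2(k - a)(k - b)`
if it does. -/
theorem residueSq_add_le {k : ℤ} (hk : 0 < k) (a b : ℤ) :
    residueSq k (a + b) ≤ residueSq k a + residueSq k b := by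
  have ha0 := Int.emod_nonneg a hk.ne'
  have ha1 := Int.emod_lt_of_pos a hk
  have hb0 := Int.emod_nonneg b hk.ne'
  have hb1 := Int.emod_lt_of_pos b hk
  have hab : residueSq k (a + b) = residueSq k (a % k + b % k) := by
    simp [residueSq, Int.add_emod]
  rw [hab]
  rcases le_total (a % k + b % k) k with h | h
  · rw [residueSq_of_le (by linarith) h]
    unfold residueSq
    nlinarith [mul_nonneg ha0 hb0]
  · rw [residueSq_eq 1 (by linarith) (by linarith)]
    unfold residueSq
    nlinarith [mul_nonneg (sub_nonneg.2 ha1.le) (sub_nonneg.2 hb1.le)]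

theorem residueSq_sum_le {k : ℤ} (hk : 0 < k) {ι : Type*} (s : Finset ι) (f : ι → ℤ) :
    residueSq k (∑ i ∈ s, f i) ≤ ∑ i ∈ s, residueSq k (f i) := by
  classical
  induction s using Finset.induction_on with
  | empty => simp [residueSq]
  | insert a s ha ih =>
    rw [Finset.sum_insert ha, Finset.sum_insert ha]
    linarith [residueSq_add_le hk (f a) (∑ i ∈ s, f i)]

theorem residueSq_succ {k : ℕ} (hk : 0 < k) (m : ℕ) :
    residueSq k ((m + 1 : ℕ) : ℤ) = residueSq k m + (k - 1) - 2 * (m % k : ℕ) := by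
  have h1 := Nat.mod_lt m hk
  have h2 : (m : ℤ) = (m % k : ℕ) + (m / k : ℕ) * k := by
    have := Nat.mod_add_div m k
    zify at this ⊢; linarith
  have h3 : ((m + 1 : ℕ) : ℤ) = ((m % k : ℕ) + 1 : ℤ) + (m / k : ℕ) * k := by push_cast at h2 ⊢; linarith
  have h4 : residueSq k (m : ℤ) = residueSq k ((m % k : ℕ) : ℤ) := by
    conv_lhs => rw [h2]
    exact residueSq_add_mul _ _ _
  have h5 : ((m % k : ℕ) : ℤ) + 1 ≤ k := by exact_mod_cast h1
  rw [h3, residueSq_add_mul, h4, residueSq_of_le (by positivity) h5,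
    residueSq_of_le (by positivity) (by linarith)]
  ring

/-- This and `two_mul_sum_div` are the reason for `residueSq`: it is the rounding term in the
coordinate sums of a grid filled in lines of length `k`. -/
theorem two_mul_sum_mod {k : ℕ} (hk : 0 < k) (M : ℕ) :
    2 * ∑ m ∈ Finset.range M, ((m % k : ℕ) : ℤ) = M * (k - 1) - residueSq k M := by
  induction M with
  | zero => simp [residueSq]
  | succ n ih =>
    rw [Finset.sum_range_succ, mul_add, ih, residueSq_succ hk]
    push_cast; ring

theorem two_mul_sum_div {k : ℕ} (hk : 0 < k) (M : ℕ) :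
    2 * (k : ℤ) * ∑ m ∈ Finset.range M, ((m / k : ℕ) : ℤ) = M ^ 2 - k * M + residueSq k M := by
  induction M with
  | zero => simp [residueSq]
  | succ n ih =>
    rw [Finset.sum_range_succ, mul_add, ih, residueSq_succ hk]
    have := Nat.mod_add_div n k
    have h : (n : ℤ) = (n % k : ℕ) + k * (n / k : ℕ) := by exact_mod_cast this.symm
    push_cast at h ⊢
    linear_combination -2 * h

/-! ### Equal weights: lower sets in a grid -/

/-- Compares filling in lines of length `c + 1` and of length `c`. The correction equals `s (c - u)`
or `u (c - s)`, hence is nonnegative in the stated range; this gives `sum_div_add_mod_mono`. -/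
theorem sum_div_add_mod_eq {c u s : ℕ} (hu : u ≤ c) (hs : s ≤ c) (h : u < c ∨ s = 0) :
    ∑ m ∈ Finset.range (u * c + s), ((m / (c + 1) + m % (c + 1) : ℕ) : ℤ) =
      ∑ m ∈ Finset.range (u * c + s), ((m / c + m % c : ℕ) : ℤ) + (c * min s u - u * s) := by
  induction u generalizing s with
  | zero =>
    rw [← sub_eq_zero, ← sub_sub, ← Finset.sum_sub_distrib]
    simp only [zero_mul, zero_add, Nat.min_zero, Nat.cast_zero, mul_zero, sub_zero]
    refine Finset.sum_eq_zero fun m hm => ?_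
    have hm : m < s := Finset.mem_range.1 hm
    rw [Nat.div_eq_of_lt (by omega), Nat.mod_eq_of_lt (by omega), Nat.div_eq_of_lt (by omega),
      Nat.mod_eq_of_lt (by omega), sub_self]
  | succ u ih =>
    induction s with
    | zero =>
      have := ih (s := c) (by omega) le_rfl (by omega)
      have e : (u + 1) * c + 0 = u * c + c := by ring
      rw [e, this, min_eq_right (by omega : u ≤ c)]
      simp; ring
    | succ s ihs =>
      have huc : u + 1 < c := by omega
      rw [← add_assoc, Finset.sum_range_succ, Finset.sum_range_succ, ihs (by omega) (by omega)]
      have e1 : ((u + 1) * c + s) / c = u + 1 := by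
        rw [mul_comm, Nat.mul_add_div (by omega), Nat.div_eq_of_lt (by omega), add_zero]
      have e2 : ((u + 1) * c + s) % c = s := by
        rw [mul_comm, Nat.mul_add_mod, Nat.mod_eq_of_lt (by omega)]
      rw [e1, e2]
      rcases lt_or_ge s (u + 1) with hlt | hge
      · have f : (u + 1) * c + s = u * (c + 1) + (c + s - u) := by
          have : u ≤ c + s := by omega
          zify [this]; ring
        have e3 : ((u + 1) * c + s) / (c + 1) = u := by
          rw [f, mul_comm, Nat.mul_add_div (by omega), Nat.div_eq_of_lt (by omega), add_zero]
        have e4 : ((u + 1) * c + s) % (c + 1) = c + s - u := by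
          rw [f, mul_comm, Nat.mul_add_mod, Nat.mod_eq_of_lt (by omega)]
        rw [e3, e4, min_eq_left hlt.le, min_eq_left (by omega : s + 1 ≤ u + 1)]
        have : u + (c + s - u) = c + s := by omega
        rw [this]; push_cast; ring
      · have f : (u + 1) * c + s = (u + 1) * (c + 1) + (s - (u + 1)) := by
          zify [hge]; ring
        have e3 : ((u + 1) * c + s) / (c + 1) = u + 1 := by
          rw [f, mul_comm, Nat.mul_add_div (by omega), Nat.div_eq_of_lt (by omega), add_zero]
        have e4 : ((u + 1) * c + s) % (c + 1) = s - (u + 1) := by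
          rw [f, mul_comm, Nat.mul_add_mod, Nat.mod_eq_of_lt (by omega)]
        rw [e3, e4, min_eq_right hge, min_eq_right (by omega : u + 1 ≤ s + 1)]
        have : u + 1 + (s - (u + 1)) = s := by omega
        rw [this]; push_cast; ring

theorem sum_div_add_mod_mono {c M : ℕ} (hc : 0 < c) (hM : M ≤ c * c) :
    ∑ m ∈ Finset.range M, (m / c + m % c) ≤
      ∑ m ∈ Finset.range M, (m / (c + 1) + m % (c + 1)) := by
  have hu : M / c ≤ c := Nat.div_le_of_le_mul hM
  have hs : M % c < c := Nat.mod_lt _ hc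
  have hM' : M / c * c + M % c = M := Nat.div_add_mod' M c
  have h : M / c < c ∨ M % c = 0 := by
    by_contra hcon
    push Not at hcon
    have : M / c = c := by omega
    rw [this] at hM'
    omega
  have key := sum_div_add_mod_eq hu hs.le h
  rw [hM'] at key
  zify at hu hs ⊢
  push_cast at key ⊢
  rw [key]
  have hm0 : (0 : ℤ) ≤ (M % c : ℤ) := Int.emod_nonneg _ (by omega)
  have hd0 : (0 : ℤ) ≤ (M / c : ℤ) := by positivity
  rcases le_total ((M % c : ℤ)) (M / c : ℤ) with h | h
  · rw [min_eq_left h]; nlinarith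
  · rw [min_eq_right h]; nlinarith

/-- Induction on `a + b`. If `S` contains a full line of length `b`, that line is removed and the
rest shifted by one. Otherwise `S` fits into an `a × (b - 1)` box, which is transposed if `a = b`;
if `a < b`, the filling by lines of length `b - 1` is no better than that by lines of length `b`, as
`S` has at most `(b - 1)²` points. -/
theorem sum_fst_add_snd_le {a b : ℕ} (hab : a ≤ b) (S : Finset (ℕ × ℕ))
    (hS : ∀ p ∈ S, p.1 < a ∧ p.2 < b) (hlow : IsLowerSet (S : Set (ℕ × ℕ))) :
    ∑ p ∈ S, (p.1 + p.2) ≤ ∑ m ∈ Finset.range S.card, (m / b + m % b) := by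
  induction hn : a + b using Nat.strong_induction_on generalizing a b S with
  | _ n ih =>
  rcases Nat.eq_zero_or_pos a with ha | ha
  · have : S = ∅ := Finset.eq_empty_of_forall_notMem fun p hp => by have := (hS p hp).1; omega
    simp [this]
  by_cases hfull : (0, b - 1) ∈ S
  · have hcol : ∀ y < b, (0, y) ∈ S := fun y hy =>
      hlow (show ((0, y) : ℕ × ℕ) ≤ (0, b - 1) from ⟨le_rfl, by simp; omega⟩) hfull
    have hi0 : Function.Injective (fun y : ℕ => ((0 : ℕ), y)) := fun y z h => (Prod.mk.inj h).2
    have hi1 : Function.Injective (fun p : ℕ × ℕ => (p.1 + 1, p.2)) := fun p q h =>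
      Prod.ext (Nat.succ_injective (Prod.mk.inj h).1) (Prod.mk.inj h).2
    obtain ⟨S', hmem⟩ : ∃ S' : Finset (ℕ × ℕ), ∀ p, p ∈ S' ↔ (p.1 + 1, p.2) ∈ S :=
      ⟨S.preimage _ hi1.injOn, fun p => Finset.mem_preimage⟩
    have hunion : S = (Finset.range b).image (fun y => ((0 : ℕ), y)) ∪
        S'.image (fun p => (p.1 + 1, p.2)) := by
      ext ⟨x, y⟩
      simp only [Finset.mem_union, Finset.mem_image, Finset.mem_range, Prod.mk.injEq, hmem]
      constructor
      · intro h
        rcases x with _ | x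
        · exact Or.inl ⟨y, (hS _ h).2, rfl, rfl⟩
        · exact Or.inr ⟨(x, y), h, rfl, rfl⟩
      · rintro (⟨y', hy', rfl, rfl⟩ | ⟨⟨x', y'⟩, h, rfl, rfl⟩)
        · exact hcol _ hy'
        · exact h
    have hdisj : Disjoint ((Finset.range b).image (fun y => ((0 : ℕ), y)))
        (S'.image (fun p => (p.1 + 1, p.2))) := by
      rw [Finset.disjoint_left]
      simp only [Finset.mem_image]
      rintro _ ⟨y, _, rfl⟩ ⟨p, _, h⟩
      simp at h
    have hcard : S.card = b + S'.card := by
      conv_lhs => rw [hunion]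
      rw [Finset.card_union_of_disjoint hdisj, Finset.card_image_of_injective _ hi0,
        Finset.card_image_of_injective _ hi1, Finset.card_range]
    have hsum : ∑ p ∈ S, (p.1 + p.2) =
        ∑ y ∈ Finset.range b, y + (∑ p ∈ S', (p.1 + p.2) + S'.card) := by
      conv_lhs => rw [hunion]
      rw [Finset.sum_union hdisj, Finset.sum_image hi0.injOn, Finset.sum_image hi1.injOn,
        Finset.card_eq_sum_ones, ← Finset.sum_add_distrib]
      congr 1
      · simp
      · exact Finset.sum_congr rfl fun p _ => by ring
    have hrec := ih (a - 1 + b) (by omega) (a := a - 1) (b := b) (by omega) S'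
      (fun p hp => by have := hS _ ((hmem p).1 hp); simp at this; omega)
      (fun p q hqp hp => by
        have hp : p ∈ S' := hp
        show q ∈ S'
        rw [hmem] at hp ⊢
        exact hlow (show (q.1 + 1, q.2) ≤ (p.1 + 1, p.2) from
          ⟨Nat.succ_le_succ hqp.1, hqp.2⟩) hp) rfl
    rw [hsum, hcard, Finset.sum_range_add]
    refine add_le_add (Finset.sum_le_sum fun y hy => ?_) ?_
    · rw [Nat.mod_eq_of_lt (Finset.mem_range.1 hy)]; exact Nat.le_add_left _ _
    · calc _ ≤ ∑ m ∈ Finset.range S'.card, (m / b + m % b) + S'.card := by omega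
        _ = ∑ m ∈ Finset.range S'.card, (m / b + m % b + 1) := by
            rw [Finset.sum_add_distrib (g := fun _ => 1)]; simp
        _ ≤ _ := Finset.sum_le_sum fun m _ => by
            rw [Nat.add_div_left _ (by omega), Nat.add_mod_left]; omega
  · have htop : ∀ p ∈ S, p.2 < b - 1 := fun p hp => by
      by_contra hcon
      exact hfull (hlow (show ((0, b - 1) : ℕ × ℕ) ≤ p from ⟨by simp, by simp; omega⟩) hp)
    rcases hab.eq_or_lt with rfl | hlt
    · have := ih (a - 1 + a) (by omega) (a := a - 1) (b := a) (by omega)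
        (S.map (Equiv.prodComm ℕ ℕ).toEmbedding)
        (fun p hp => by
          simp only [Finset.mem_map_equiv, Equiv.prodComm_symm, Equiv.prodComm_apply] at hp
          exact ⟨htop _ hp, (hS _ hp).1⟩)
        (fun p q hqp hp => by
          simp only [Finset.mem_coe, Finset.mem_map_equiv, Equiv.prodComm_symm,
            Equiv.prodComm_apply] at hp ⊢
          exact hlow (show q.swap ≤ p.swap from ⟨hqp.2, hqp.1⟩) hp) rfl
      simpa [add_comm] using this
    · have h1 := ih (a + (b - 1)) (by omega) (a := a) (b := b - 1) (by omega) S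
        (fun p hp => ⟨(hS p hp).1, htop p hp⟩) hlow rfl
      have hcard : S.card ≤ (b - 1) * (b - 1) := by
        calc S.card ≤ (Finset.range (b - 1) ×ˢ Finset.range (b - 1)).card :=
              Finset.card_le_card fun p hp => by
                simp only [Finset.mem_product, Finset.mem_range]
                exact ⟨by have := (hS p hp).1; omega, htop p hp⟩
          _ = _ := by simp
      have h2 := sum_div_add_mod_mono (c := b - 1) (by omega) hcard
      rw [Nat.sub_add_cancel (by omega)] at h2
      exact h1.trans h2

/-! ### A quantitative gap in the subadditivity of `residueSq` -/

/-- The window inequality: `k + 1` values between `β` and `k - γ`, both attained. -/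
theorem window_residueSq {β γ m W k : ℤ} (hβ : 0 < β) (hγ : 0 < γ) (hm : 0 < m)
    (hk : k = β + γ + m) (hW : m ≤ W) (hW' : W ≤ k * m) :
    residueSq k (β + W) ≤ residueSq k β + (γ * W + β * (k * m - W)) := by
  have hkpos : 0 < k := by linarith
  rw [residueSq_of_le hβ.le (by linarith)]
  rcases le_total (β + W) k with h | h
  · rw [residueSq_of_le (by linarith) h]
    have : 0 ≤ W * (W + β - m) := mul_nonneg (by linarith) (by linarith)
    have h2 : 0 ≤ β * (k * m - W) := mul_nonneg hβ.le (by linarith)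
    subst hk; nlinarith
  rcases le_total (k * m - W) β with h' | h'
  · have e : β + W = (β - (k * m - W)) + m * k := by ring
    rw [e, residueSq_add_mul, residueSq_of_le (by linarith) (by nlinarith)]
    have : 0 ≤ (k * m - W) * (k - β + (k * m - W)) :=
      mul_nonneg (by linarith) (by linarith)
    have h2 : 0 ≤ γ * W := mul_nonneg hγ.le (by linarith)
    nlinarith
  -- Away from both ends of the range of `W` the crude bound `k² / 4` suffices. If `β` and `γ` are
  -- both below `k / 4`, then `m > k / 2`, and the right side exceeds `k m > k² / 2`.
  · have hR := four_mul_residueSq_le k (β + W)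
    have h1 : 0 ≤ γ * (W - (k - β)) := mul_nonneg hγ.le (by linarith)
    have h2 : 0 ≤ β * ((k * m - W) - β) := mul_nonneg hβ.le (by linarith)
    by_cases c1 : k ≤ 4 * β
    · nlinarith [mul_nonneg hγ.le (by linarith : (0:ℤ) ≤ k - β)]
    · by_cases c2 : k ≤ 4 * γ
      · nlinarith [mul_nonneg (sub_nonneg.2 c2) (by linarith : (0:ℤ) ≤ k - β), mul_nonneg hβ.le hkpos.le]
      · have hm2 : k < 2 * m := by linarith
        have h3 : k * m ≤ γ * W + β * (k * m - W) := by
          nlinarith [mul_nonneg (by linarith : (0:ℤ) ≤ γ - 1) (by linarith : (0:ℤ) ≤ W),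
            mul_nonneg (by linarith : (0:ℤ) ≤ β - 1) (by linarith : (0:ℤ) ≤ k * m - W)]
        nlinarith [mul_nonneg hβ.le (by linarith : (0:ℤ) ≤ k - β)]

/-- Only the window of indices `x, …, x + k` matters; subadditivity handles the rest. The `k` copies
of `β = b (x + k)` vanish modulo `k`, so the window sum is `β + W` there, and `window_residueSq`
applies. -/
theorem residueSq_gap_window {k K : ℕ} (hk : 0 < k) (b : ℕ → ℕ) (hb : Antitone b)
    (hbk : ∀ x, b x ≤ k) {x : ℕ} (hx : x + k < K) :
    (k : ℤ) * (b (x + k) * (k - b x)) ≤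
      ∑ i ∈ Finset.range K, residueSq k (b i) - residueSq k (∑ i ∈ Finset.range K, (b i : ℤ)) := by
  have hkz : (0 : ℤ) < k := by exact_mod_cast hk
  have hgap := residueSq_sum_le hkz (Finset.range K) (fun i => (b i : ℤ))
  have hax : (b x : ℤ) ≤ k := by exact_mod_cast hbk x
  have hle : (b (x + k) : ℤ) ≤ b x := by exact_mod_cast hb (Nat.le_add_right x k)
  rcases Nat.eq_zero_or_pos (b (x + k)) with h0 | hβ
  · rw [h0]; simpa using hgap
  rcases hax.eq_or_lt with h0 | hγ
  · rw [h0]; simpa using hgap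
  have hβ' : (0 : ℤ) < b (x + k) := by exact_mod_cast hβ
  set β : ℤ := ((b (x + k) : ℕ) : ℤ) with hβdef
  set a : ℤ := ((b x : ℕ) : ℤ) with hadef
  set s := Finset.Ico x (x + k) with hs
  have hsK : Finset.Ico x (x + k + 1) ⊆ Finset.range K := fun i hi => by
    simp only [Finset.mem_Ico, Finset.mem_range] at hi ⊢; omega
  have hwin : ∀ f : ℕ → ℤ, ∑ i ∈ Finset.Ico x (x + k + 1), f i = ∑ i ∈ s, f i + f (x + k) :=
    fun f => Finset.sum_Ico_succ_top (by omega) f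
  have hrest := residueSq_add_le hkz
    (∑ i ∈ Finset.range K \ Finset.Ico x (x + k + 1), (b i : ℤ))
    (∑ i ∈ Finset.Ico x (x + k + 1), (b i : ℤ))
  have hrest' := residueSq_sum_le hkz (Finset.range K \ Finset.Ico x (x + k + 1))
    (fun i => (b i : ℤ))
  rw [Finset.sum_sdiff hsK] at hrest
  rw [← Finset.sum_sdiff hsK (f := fun i => residueSq (k : ℤ) (b i))]
  set W := ∑ i ∈ s, ((b i : ℤ) - β) with hW
  have hmem : ∀ i ∈ s, β ≤ b i ∧ (b i : ℤ) ≤ a := fun i hi => by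
    simp only [hs, Finset.mem_Ico] at hi
    exact ⟨Nat.cast_le.2 (hb hi.2.le), Nat.cast_le.2 (hb hi.1)⟩
  have hscard : (s.card : ℤ) = k := by simp [hs]
  have hsum : ∑ i ∈ Finset.Ico x (x + k + 1), (b i : ℤ) = β + W + β * k := by
    rw [hwin, hW, Finset.sum_sub_distrib, Finset.sum_const, nsmul_eq_mul, hscard]; ring
  have hWm : a - β ≤ W := by
    have hxs : x ∈ s := by simp [hs]; omega
    exact Finset.single_le_sum (f := fun i => (b i : ℤ) - β)
      (fun i hi => sub_nonneg.2 (hmem i hi).1) hxs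
  have hWk : W ≤ k * (a - β) := by
    have := Finset.sum_le_card_nsmul s (fun i => (b i : ℤ) - β) (a - β)
      fun i hi => by linarith [(hmem i hi).2]
    rwa [nsmul_eq_mul, hscard] at this
  -- For `β ≤ t ≤ a`, expanding `t (k - t)` with `t = β + (t - β)` and `k - t = (k - a) + (a - t)`
  -- and dropping `(t - β)(a - t)` gives the summand.
  have hR : k * (β * (k - a)) + ((k - a) * W + β * (k * (a - β) - W)) ≤
      ∑ i ∈ s, residueSq k (b i) := by
    have : ∑ i ∈ s, (β * (k - a) + ((k - a) * ((b i : ℤ) - β) + β * (a - β - (b i - β)))) ≤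
        ∑ i ∈ s, residueSq k (b i) := Finset.sum_le_sum fun i hi => by
      obtain ⟨h1, h2⟩ := hmem i hi
      rw [residueSq_of_le (by linarith) (by linarith)]
      nlinarith [mul_nonneg (sub_nonneg.2 h1) (sub_nonneg.2 h2)]
    refine le_trans (le_of_eq ?_) this
    simp only [Finset.sum_add_distrib, ← Finset.mul_sum, Finset.sum_sub_distrib, Finset.sum_const,
      nsmul_eq_mul, hscard, hW]
    ring
  rw [hsum, residueSq_add_mul] at hrest
  rw [hwin (fun i => residueSq (k : ℤ) (b i))]
  have hkey : residueSq k (β + W) ≤ residueSq k β + ((k - a) * W + β * (k * (a - β) - W)) := by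
    rcases hle.eq_or_lt with h0 | hm
    · have : a - β = 0 := by linarith
      rw [this, mul_zero] at hWk
      have hW0 : W = 0 := by linarith
      rw [hW0, this]; simp
    · exact window_residueSq hβ' (by linarith) (by linarith) (by ring) hWm hWk
  linarith

/-! ### Row lengths, column heights and the equal-weight theorem modulo `k` -/

section RowLengths

variable {k : ℕ} (c : Fin k → ℕ)

/-- The number of rows that are longer than `x`. -/
def columnHeight (x : ℕ) : ℕ := (Finset.univ.filter fun y => x < c y).card

theorem columnHeight_antitone : Antitone (columnHeight c) := fun _ _ h =>
  Finset.card_le_card fun y hy => by simp at hy ⊢; omega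

theorem columnHeight_le (x : ℕ) : columnHeight c x ≤ k := by
  unfold columnHeight
  exact (Finset.card_le_univ _).trans (by simp)

theorem columnHeight_eq_sum (x : ℕ) :
    columnHeight c x = ∑ y, if x < c y then 1 else 0 := by
  rw [columnHeight, Finset.card_filter]

theorem sum_mul_columnHeight {K : ℕ} (hc : ∀ y, c y ≤ K) (f : ℕ → ℕ) :
    ∑ x ∈ Finset.range K, f x * columnHeight c x = ∑ y, ∑ x ∈ Finset.range (c y), f x := by
  simp_rw [columnHeight_eq_sum, Finset.mul_sum]
  rw [Finset.sum_comm]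
  refine Finset.sum_congr rfl fun y _ => ?_
  simp_rw [mul_ite, mul_one, mul_zero]
  rw [← Finset.sum_filter]
  congr 1
  ext x; have := hc y; simp; omega

theorem sum_columnHeight {K : ℕ} (hc : ∀ y, c y ≤ K) :
    ∑ x ∈ Finset.range K, columnHeight c x = ∑ y, c y := by
  simpa using sum_mul_columnHeight c hc (fun _ => 1)

theorem sum_columnHeight_sq {K : ℕ} (hc : ∀ y, c y ≤ K) :
    ∑ x ∈ Finset.range K, columnHeight c x ^ 2 = ∑ y, ∑ z, min (c y) (c z) := by
  simp_rw [columnHeight_eq_sum, sq, Finset.sum_mul_sum]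
  rw [Finset.sum_comm]
  refine Finset.sum_congr rfl fun y _ => ?_
  rw [Finset.sum_comm]
  refine Finset.sum_congr rfl fun z _ => ?_
  have h : ∀ x, ((if x < c y then 1 else 0) * if x < c z then 1 else 0) =
      if x < c y ∧ x < c z then 1 else 0 := fun x => by split_ifs <;> simp_all
  simp_rw [h]
  rw [← Finset.card_filter]
  conv_rhs => rw [← Finset.card_range (min (c y) (c z))]
  congr 1
  ext x; have := hc y; simp; omega

theorem sum_sum_abs_sub_mul :
    ∑ y, ∑ z, |(c y : ℤ) - c z| * (k - |(c y : ℤ) - c z|) =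
      2 * k ^ 2 * (∑ y, c y : ℕ) + 2 * (∑ y, c y : ℕ) ^ 2 -
        2 * k * ((∑ y, ∑ z, min (c y) (c z) : ℕ) + (∑ y, c y ^ 2 : ℕ)) := by
  have h : ∀ y z, |(c y : ℤ) - c z| * (k - |(c y : ℤ) - c z|) =
      k * c y + k * c z - 2 * k * (min (c y) (c z) : ℕ) - c y ^ 2 - c z ^ 2 + 2 * (c y * c z) := by
    intro y z
    have h1 : |(c y : ℤ) - c z| = c y + c z - 2 * (min (c y) (c z) : ℕ) := by
      rcases le_total (c y) (c z) with h | h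
      · have : (c y : ℤ) ≤ c z := by exact_mod_cast h
        rw [min_eq_left h, abs_of_nonpos (by linarith)]; ring
      · have : (c z : ℤ) ≤ c y := by exact_mod_cast h
        rw [min_eq_right h, abs_of_nonneg (by linarith)]; ring
    rw [mul_sub, abs_mul_abs_self, h1]; ring
  simp_rw [h, Finset.sum_add_distrib, Finset.sum_sub_distrib, Finset.sum_add_distrib,
    ← Finset.mul_sum, Finset.sum_const, Finset.card_univ, Fintype.card_fin, nsmul_eq_mul,
    ← Finset.mul_sum, ← Finset.sum_mul]
  push_cast
  ring

/-- Both sides depend only on the `c y` modulo `k`. For residues the row lengths define a lower set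
in a `k × k` square, and the claim is `sum_fst_add_snd_le` for it, written with sums of squares. -/
theorem two_mul_residueSq_sum_le :
    2 * ((k : ℤ) - 1) * residueSq k (∑ y, c y : ℕ) ≤ ∑ y, ∑ z, residueSq k ((c y : ℤ) - c z) := by
  rcases Nat.eq_zero_or_pos k with rfl | hk
  · simp [residueSq]
  have hkz : (0 : ℤ) < k := by exact_mod_cast hk
  set r : Fin k → ℕ := fun y => c y % k with hr
  have hrk : ∀ y, r y < k := fun y => Nat.mod_lt _ hk
  have hrz : ∀ y, (c y : ℤ) = r y + (c y / k : ℕ) * k := fun y => by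
    have := Nat.mod_add_div' (c y) k
    rw [hr]; exact_mod_cast this.symm
  set M := ∑ y, r y with hM
  have e1 : residueSq k (∑ y, c y : ℕ) = residueSq k M := by
    have : ((∑ y, c y : ℕ) : ℤ) = M + (∑ y, (c y / k : ℕ) : ℤ) * k := by
      rw [hM, Finset.sum_mul]
      push_cast
      rw [← Finset.sum_add_distrib]
      exact Finset.sum_congr rfl fun y _ => by simpa using hrz y
    rw [this, residueSq_add_mul]
  have e2 : ∀ y z, residueSq k ((c y : ℤ) - c z) = |(r y : ℤ) - r z| * (k - |(r y : ℤ) - r z|) := by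
    intro y z
    have : (c y : ℤ) - c z = (r y - r z) + ((c y / k : ℕ) - (c z / k : ℕ) : ℤ) * k := by
      rw [hrz y, hrz z]
      have hy := hrz y
      have hz := hrz z
      linear_combination hy - hz + hrz z - hrz y
    rw [this, residueSq_add_mul, ← residueSq_abs hkz, residueSq_of_le (abs_nonneg _)]
    have h1 : (r y : ℤ) < k := by exact_mod_cast hrk y
    have h2 : (r z : ℤ) < k := by exact_mod_cast hrk z
    rw [abs_le]; constructor <;> linarith [Int.natCast_nonneg (r y), Int.natCast_nonneg (r z)]
  simp_rw [e2]
  rw [sum_sum_abs_sub_mul, e1, ← sum_columnHeight_sq r (fun y => (hrk y).le)]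
  set b := columnHeight r with hb
  set S : Finset (ℕ × ℕ) := (Finset.range k ×ˢ Finset.range k).filter (fun p => p.2 < b p.1)
    with hSdef
  have hS : ∀ p, p ∈ S ↔ p.1 ∈ Finset.range k ∧ p.2 ∈ Finset.range (b p.1) := fun p => by
    have : b p.1 ≤ k := columnHeight_le r p.1
    simp only [hSdef, Finset.mem_filter, Finset.mem_product, Finset.mem_range]; omega
  have hA := sum_fst_add_snd_le (a := k) (b := k) le_rfl S
    (fun p hp => by
      have := (hS p).1 hp
      have h2 : b p.1 ≤ k := columnHeight_le r p.1
      simp only [Finset.mem_range] at this; omega)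
    (fun p q hqp hp => by
      have hp := (hS p).1 hp
      refine (hS q).2 ?_
      have h1 : q.1 ≤ p.1 := hqp.1
      have h2 : q.2 ≤ p.2 := hqp.2
      have h3 : b p.1 ≤ b q.1 := columnHeight_antitone r h1
      simp only [Finset.mem_range] at hp ⊢; omega)
  have hcard : S.card = M := by
    rw [Finset.card_eq_sum_ones, Finset.sum_finset_product S (Finset.range k) (fun x => Finset.range (b x)) hS]
    simpa using sum_columnHeight r (fun y => (hrk y).le)
  have hx : 2 * ∑ p ∈ S, (p.1 : ℤ) = (∑ y, r y ^ 2 : ℕ) - M := by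
    have := sum_mul_columnHeight r (fun y => (hrk y).le) id
    rw [← Nat.cast_sum, Finset.sum_finset_product S (Finset.range k) (fun x => Finset.range (b x)) hS]
    simp only [Finset.sum_const, Finset.card_range, smul_eq_mul]
    rw [Finset.sum_congr rfl fun x _ => mul_comm (b x) x]
    simp only [id] at this
    rw [this]
    push_cast
    rw [hM, Finset.mul_sum, Nat.cast_sum, ← Finset.sum_sub_distrib]
    refine Finset.sum_congr rfl fun y _ => ?_
    have := Finset.sum_range_id_mul_two (r y)
    zify at this
    rw [mul_comm, this]
    rcases Nat.eq_zero_or_pos (r y) with h | h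
    · rw [h]; simp
    · push_cast [Nat.cast_sub (show 1 ≤ r y from h)]; ring
  have hy : 2 * ∑ p ∈ S, (p.2 : ℤ) = (∑ x ∈ Finset.range k, b x ^ 2 : ℕ) - M := by
    rw [← Nat.cast_sum, Finset.sum_finset_product S (Finset.range k) (fun x => Finset.range (b x)) hS, hM,
      ← sum_columnHeight r (fun y => (hrk y).le)]
    push_cast
    rw [Finset.mul_sum, ← Finset.sum_sub_distrib]
    refine Finset.sum_congr rfl fun x _ => ?_
    have := Finset.sum_range_id_mul_two (b x)
    zify at this
    rw [mul_comm, this]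
    rcases Nat.eq_zero_or_pos (b x) with h | h
    · rw [h]; simp [← hb, h]
    · push_cast [Nat.cast_sub (show 1 ≤ b x from h)]; ring
  rw [hcard] at hA
  zify at hA
  rw [Finset.sum_add_distrib, Finset.sum_add_distrib] at hA
  have d1 := two_mul_sum_mod hk M
  have d2 := two_mul_sum_div hk M
  push_cast at hA d1 d2 hx hy ⊢
  have hA' := mul_le_mul_of_nonneg_left hA (by positivity : (0 : ℤ) ≤ 2 * k)
  nlinarith

end RowLengths

/-! ### Unequal weights: gain in one coordinate against loss in the other -/

theorem sum_range_sub_div {u K : ℕ} (hu : u ≤ K) (v k : ℕ) :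
    ∑ m ∈ Finset.range (u - v), m / k =
      ∑ x ∈ Finset.range K, if v ≤ x then (u - 1 - x) / k else 0 := by
  rw [← Finset.sum_filter]
  have : ∑ x ∈ Finset.Ico v u, (u - 1 - x) / k =
      ∑ x ∈ (Finset.range K).filter (v ≤ ·), (u - 1 - x) / k := by
    refine Finset.sum_subset (fun x hx => ?_) (fun x hx hx' => ?_)
    · simp only [Finset.mem_Ico, Finset.mem_filter, Finset.mem_range] at hx ⊢; omega
    · simp only [Finset.mem_Ico, Finset.mem_filter, Finset.mem_range] at hx hx'
      rw [show u - 1 - x = 0 by omega, Nat.zero_div]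
  rw [← this, Finset.sum_Ico_eq_sum_range, ← Finset.sum_range_reflect]
  exact Finset.sum_congr rfl fun x _ => by congr 1; omega

theorem residueSq_natCast_sub {k : ℕ} (hk : 0 < k) (u v : ℕ) :
    residueSq k ((u : ℤ) - v) = |(u : ℤ) - v| * (k - |(u : ℤ) - v|) +
      2 * k * ((∑ m ∈ Finset.range (u - v), m / k + ∑ m ∈ Finset.range (v - u), m / k : ℕ) : ℤ) := by
  rw [← residueSq_abs (by exact_mod_cast hk)]
  have h : ∀ n : ℕ, residueSq k (n : ℤ) = n * (k - n) + 2 * k * (∑ m ∈ Finset.range n, m / k : ℕ) := by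
    intro n
    have := two_mul_sum_div hk n
    push_cast at this ⊢
    linarith
  rcases le_total u v with huv | huv
  · rw [show |(u : ℤ) - v| = ((v - u : ℕ) : ℤ) by
      rw [abs_of_nonpos (by have : (u : ℤ) ≤ v := by exact_mod_cast huv
                            linarith)]
      push_cast [huv]; ring, h, Nat.sub_eq_zero_of_le huv]
    simp
  · rw [show |(u : ℤ) - v| = ((u - v : ℕ) : ℤ) by
      rw [abs_of_nonneg (by have : (v : ℤ) ≤ u := by exact_mod_cast huv
                            linarith)]
      push_cast [huv]; ring, h, Nat.sub_eq_zero_of_le huv]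
    simp

section RowLengths

variable {k : ℕ} (c : Fin k → ℕ)

/-- The total excess of the differences of the row lengths over multiples of `k`. -/
def rowExcess (K : ℕ) : ℕ :=
  ∑ x ∈ Finset.range K, (k - columnHeight c x) * ∑ y, (c y - 1 - x) / k

theorem sum_sum_sub_div {K : ℕ} (hc : ∀ y, c y ≤ K) :
    ∑ y, ∑ z, ∑ m ∈ Finset.range (c y - c z), m / k = rowExcess c K := by
  simp_rw [fun y z => sum_range_sub_div (hc y) (c z) k]
  rw [Finset.sum_comm]
  rw [Finset.sum_congr rfl fun z _ => Finset.sum_comm, Finset.sum_comm]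
  refine Finset.sum_congr rfl fun x _ => ?_
  have h : k - columnHeight c x = ∑ z, if c z ≤ x then 1 else 0 := by
    rw [← Finset.card_filter, columnHeight]
    have := Finset.card_filter_add_card_filter_not (s := (Finset.univ : Finset (Fin k)))
      (fun y => x < c y)
    simp only [not_lt, Finset.card_univ, Fintype.card_fin] at this
    omega
  rw [h, Finset.sum_mul]
  refine Finset.sum_congr rfl fun z _ => ?_
  split_ifs <;> simp

/-- The amount by which the column heights exceed the optimum for columns. -/
def columnGap (K : ℕ) : ℤ :=
  ∑ x ∈ Finset.range K, residueSq k (columnHeight c x) -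
    residueSq k (∑ x ∈ Finset.range K, (columnHeight c x : ℤ))

theorem columnGap_nonneg (hk : 0 < k) (K : ℕ) : 0 ≤ columnGap c K :=
  sub_nonneg.2 (residueSq_sum_le (by exact_mod_cast hk) _ _)

theorem columnGap_eq {K : ℕ} (hc : ∀ y, c y ≤ K) :
    columnGap c K = k * (∑ y, c y : ℕ) - (∑ x ∈ Finset.range K, columnHeight c x ^ 2 : ℕ) -
      residueSq k (∑ y, c y : ℕ) := by
  rw [columnGap, ← Nat.cast_sum, sum_columnHeight c hc, ← sum_columnHeight c hc]
  congr 1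
  push_cast
  rw [Finset.mul_sum, ← Finset.sum_sub_distrib]
  refine Finset.sum_congr rfl fun x _ => ?_
  rw [residueSq_of_le (by positivity) (by exact_mod_cast columnHeight_le c x)]
  ring

/-- After division by `k`: twice the first coordinate sum exceeds its value for filled columns by at
most `columnGap + 2 rowExcess`. The excess term arises because differences of row lengths may exceed
`k`. -/
theorem mul_sum_sq_le (hk : 0 < k) {K : ℕ} (hc : ∀ y, c y ≤ K) :
    (k : ℤ) * (∑ y, c y ^ 2 : ℕ) ≤ (∑ y, c y : ℕ) ^ 2 + residueSq k (∑ y, c y : ℕ) +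
      k * columnGap c K + 2 * k * rowExcess c K := by
  have h1 := two_mul_residueSq_sum_le c
  have h2 : ∑ y, ∑ z, residueSq k ((c y : ℤ) - c z) =
      ∑ y, ∑ z, |(c y : ℤ) - c z| * (k - |(c y : ℤ) - c z|) + 4 * k * rowExcess c K := by
    simp_rw [residueSq_natCast_sub hk, Finset.sum_add_distrib, ← Finset.mul_sum,
      ← Nat.cast_sum, Finset.sum_add_distrib]
    have h3 : ∑ y, ∑ z, ∑ m ∈ Finset.range (c z - c y), m / k = rowExcess c K := by
      rw [Finset.sum_comm, sum_sum_sub_div c hc]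
    rw [sum_sum_sub_div c hc, h3]
    push_cast; ring
  rw [h2, sum_sum_abs_sub_mul, ← sum_columnHeight_sq c hc] at h1
  rw [columnGap_eq c hc]
  push_cast at h1 ⊢
  nlinarith

/-- At level `x` only the `columnHeight c (x + k)` rows longer than `x + k` contribute, each at most
`(K - 1 - x) / k`. The product of this number with `k - columnHeight c x` is what
`residueSq_gap_window` bounds. -/
theorem mul_rowExcess_le (hk : 0 < k) {K : ℕ} (hc : ∀ y, c y ≤ K) :
    (k : ℤ) * rowExcess c K ≤ (∑ m ∈ Finset.range K, m / k : ℕ) * columnGap c K := by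
  rw [← Finset.sum_range_reflect, rowExcess]
  push_cast
  rw [Finset.mul_sum, Finset.sum_mul]
  refine Finset.sum_le_sum fun x hx => ?_
  have hx := Finset.mem_range.1 hx
  have hnn := columnGap_nonneg c hk K
  rcases lt_or_ge (x + k) K with hxk | hxk
  · have h1 := residueSq_gap_window hk (columnHeight c) (columnHeight_antitone c)
      (columnHeight_le c) hxk
    have h2 : ∑ y, (c y - 1 - x) / k ≤ columnHeight c (x + k) * ((K - 1 - x) / k) := by
      rw [columnHeight_eq_sum, Finset.sum_mul]
      refine Finset.sum_le_sum fun y _ => ?_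
      split_ifs with h
      · rw [one_mul]
        have := hc y
        exact Nat.div_le_div_right (by omega)
      · rw [Nat.div_eq_of_lt (by omega)]; simp
    have h3 : ((∑ y, (c y - 1 - x) / k : ℕ) : ℤ) ≤
        columnHeight c (x + k) * ((K - 1 - x) / k : ℕ) := by exact_mod_cast h2
    have hb := columnHeight_le c x
    have hb' : (0 : ℤ) ≤ k - columnHeight c x := by
      have : (columnHeight c x : ℤ) ≤ k := by exact_mod_cast hb
      linarith
    have h4 := mul_le_mul_of_nonneg_left h3 (mul_nonneg (Int.natCast_nonneg k) hb')
    have h5 := mul_le_mul_of_nonneg_left h1 (Int.natCast_nonneg ((K - 1 - x) / k))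
    rw [← columnGap] at h5
    push_cast [Nat.cast_sub hb] at h4 h5 ⊢
    linarith
  · have h0 : ∀ y, (c y - 1 - x) / k = 0 := fun y => Nat.div_eq_of_lt (by have := hc y; omega)
    have h0' : ∀ y, (((c y - 1 - x : ℕ) : ℤ)) / k = 0 := fun y => by exact_mod_cast h0 y
    simp only [h0', Finset.sum_const_zero, mul_zero]
    positivity

theorem sq_mul_gap_add_excess_le (hk : 0 < k) {K : ℕ} (hK : k < K) (hc : ∀ y, c y ≤ K) :
    (k : ℤ) ^ 2 * (columnGap c K + 2 * rowExcess c K) ≤ (K ^ 2 - 1) * columnGap c K := by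
  have h1 := mul_rowExcess_le c hk hc
  have h2 := two_mul_sum_div hk K
  have hnn := columnGap_nonneg c hk K
  have hkz : (0 : ℤ) < k := by exact_mod_cast hk
  have hKz : (k : ℤ) < K := by exact_mod_cast hK
  -- The `- 1` is essential: it produces `K² - 1` instead of `K²`, and the balanced weights of odd
  -- sides allow no more.
  have h3 : residueSq k K ≤ k * (K - k) - 1 := by
    have e : (K : ℤ) = (K - k) + 1 * k := by ring
    rw [e, residueSq_add_mul, residueSq]
    have a0 := Int.emod_nonneg ((K : ℤ) - k) hkz.ne'
    have a1 := Int.emod_lt_of_pos ((K : ℤ) - k) hkz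
    have a2 : ((K : ℤ) - k) % k ≤ K - k := by
      have := Int.emod_add_mul_ediv ((K : ℤ) - k) k
      have := mul_nonneg hkz.le (Int.ediv_nonneg (by linarith : (0 : ℤ) ≤ K - k) hkz.le)
      linarith
    set r := ((K : ℤ) - k) % k
    rcases a0.eq_or_lt with h | h
    · rw [← h]; nlinarith
    · nlinarith
  have h4 : (2 * k * (∑ m ∈ Finset.range K, m / k : ℕ) : ℤ) ≤ K ^ 2 - 1 - k ^ 2 := by
    push_cast at h2 ⊢
    linarith
  have h5 := mul_le_mul_of_nonneg_right h4 hnn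
  have h6 := mul_le_mul_of_nonneg_left h1 (by linarith : (0 : ℤ) ≤ 2 * k)
  linarith

theorem weighted_sum_sq_le (hk : 0 < k) {K : ℕ} (hc : ∀ y, c y ≤ K) {w₁ w₂ : ℚ} (h₁ : 0 ≤ w₁)
    (h₁₂ : w₁ ≤ w₂) (hw : K ≤ k ∨ w₁ * (K ^ 2 - 1) ≤ w₂ * k ^ 2) :
    w₁ * ((∑ y, c y ^ 2 : ℕ) - (∑ y, c y : ℕ)) +
        w₂ * ((∑ x ∈ Finset.range K, columnHeight c x ^ 2 : ℕ) - (∑ y, c y : ℕ)) ≤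
      2 * ∑ m ∈ Finset.range (∑ y, c y), (w₁ * (m / k : ℕ) + w₂ * (m % k : ℕ)) := by
  have hG := columnGap_nonneg c hk K
  have hGeq := columnGap_eq c hc
  have hsq := mul_sum_sq_le c hk hc
  set G := columnGap c K
  set M := ∑ y, c y
  set R := residueSq k M
  have hkq : (0 : ℚ) < k := by exact_mod_cast hk
  -- The possible gain in the first coordinate against the exact loss `G` in the second, both
  -- doubled.
  have key : w₁ * (G + 2 * rowExcess c K) ≤ w₂ * G := by
    have hGq : (0 : ℚ) ≤ G := by exact_mod_cast hG
    rcases le_or_gt K k with hKk | hKk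
    · have h1 := mul_rowExcess_le c hk hc
      have h0 : ∑ m ∈ Finset.range K, m / k = 0 := Finset.sum_eq_zero fun m hm =>
        Nat.div_eq_of_lt ((Finset.mem_range.1 hm).trans_le hKk)
      rw [h0] at h1
      have : rowExcess c K = 0 := by
        have : k * rowExcess c K ≤ 0 := by 
          rw [Nat.cast_zero, zero_mul] at h1
          exact_mod_cast h1
        rcases Nat.mul_eq_zero.1 (Nat.le_zero.1 this) with h | h
        · omega
        · exact h
      rw [this]
      simpa using mul_le_mul_of_nonneg_right h₁₂ hGq
    · have hw := hw.resolve_left (by omega)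
      have h1 := sq_mul_gap_add_excess_le c hk hKk hc
      have h1q : (k : ℚ) ^ 2 * (G + 2 * rowExcess c K) ≤ (K ^ 2 - 1) * G := by exact_mod_cast h1
      have h2 := mul_le_mul_of_nonneg_left h1q h₁
      have h3 := mul_le_mul_of_nonneg_right hw hGq
      have h4 : (k : ℚ) ^ 2 * (w₁ * (G + 2 * rowExcess c K)) ≤ (k : ℚ) ^ 2 * (w₂ * G) := by
        linarith
      exact le_of_mul_le_mul_left h4 (by positivity)
  have hdiv : 2 * (k : ℚ) * ∑ m ∈ Finset.range M, ((m / k : ℕ) : ℚ) = M ^ 2 - k * M + R := by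
    have : 2 * (k : ℤ) * ∑ m ∈ Finset.range M, ((m / k : ℕ) : ℤ) = M ^ 2 - k * M + R :=
      two_mul_sum_div hk M
    simpa [-Int.natCast_ediv, -Int.natCast_emod] using congrArg (Int.cast : ℤ → ℚ) this
  have hmod : 2 * ∑ m ∈ Finset.range M, ((m % k : ℕ) : ℚ) = M * (k - 1) - R := by
    have : 2 * ∑ m ∈ Finset.range M, ((m % k : ℕ) : ℤ) = M * (k - 1) - R :=
      two_mul_sum_mod hk M
    simpa [-Int.natCast_ediv, -Int.natCast_emod, -Int.natCast_mod] using congrArg (Int.cast : ℤ → ℚ) this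
  have hGq : (G : ℚ) = k * M - (∑ x ∈ Finset.range K, columnHeight c x ^ 2 : ℕ) - R := by
    exact_mod_cast hGeq
  have hsqq : (k : ℚ) * (∑ y, c y ^ 2 : ℕ) ≤ M ^ 2 + R + k * G + 2 * k * rowExcess c K := by
    exact_mod_cast hsq
  rw [Finset.sum_add_distrib, ← Finset.mul_sum, ← Finset.mul_sum]
  refine le_of_mul_le_mul_left (a := (k : ℚ)) ?_ hkq
  have e1 := mul_le_mul_of_nonneg_left hsqq h₁
  have e2 := mul_le_mul_of_nonneg_left key hkq.le
  linear_combination e1 + e2 - w₁ * hdiv - w₂ * k * hmod + w₂ * k * hGq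

end RowLengths

/-! ### The weighted grid theorem for lower sets -/

theorem mem_iff_lt_card_of_isLowerSet {A : Finset ℕ} (hA : IsLowerSet (A : Set ℕ)) {x : ℕ} :
    x ∈ A ↔ x < A.card := by
  constructor
  · intro hx
    have : Finset.range (x + 1) ⊆ A := fun y hy =>
      hA (Nat.lt_succ_iff.1 (Finset.mem_range.1 hy)) hx
    simpa using Finset.card_le_card this
  · intro hx
    by_contra hn
    have : A ⊆ Finset.range x := fun y hy => by
      rw [Finset.mem_range]
      by_contra h
      exact hn (hA (not_lt.1 h) hy)
    have := Finset.card_le_card this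
    simp at this; omega

theorem two_mul_sum_range_cast (n : ℕ) : 2 * ∑ i ∈ Finset.range n, (i : ℚ) = n ^ 2 - n := by
  induction n with
  | zero => simp
  | succ n ih => rw [Finset.sum_range_succ, mul_add, ih]; push_cast; ring

/-- Among the lower sets of a `K × k` grid of given size, the union of columns filled in order
has the largest weighted coordinate sum. -/
theorem weighted_sum_le_of_isLowerSet {k K : ℕ} (hk : 0 < k) (S : Finset (ℕ × ℕ))
    (hS : ∀ p ∈ S, p.1 < K ∧ p.2 < k) (hlow : IsLowerSet (S : Set (ℕ × ℕ))) {w₁ w₂ : ℚ}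
    (h₁ : 0 ≤ w₁) (h₁₂ : w₁ ≤ w₂) (hw : K ≤ k ∨ w₁ * (K ^ 2 - 1) ≤ w₂ * k ^ 2) :
    ∑ p ∈ S, (w₁ * p.1 + w₂ * p.2) ≤
      ∑ m ∈ Finset.range S.card, (w₁ * (m / k : ℕ) + w₂ * (m % k : ℕ)) := by
  set r : ℕ → ℕ := fun y => ((Finset.range K).filter fun x => (x, y) ∈ S).card with hr
  set c : Fin k → ℕ := fun y => r y with hcdef
  have hmem : ∀ x y, (x, y) ∈ S ↔ x < r y := fun x y => by
    rw [hr]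
    dsimp only
    rw [← mem_iff_lt_card_of_isLowerSet]
    · simp only [Finset.mem_filter, Finset.mem_range]
      exact ⟨fun h => ⟨(hS _ h).1, h⟩, fun h => h.2⟩
    · intro x x' hx hx'
      simp only [Finset.coe_filter, Finset.mem_range, Set.mem_ofPred_eq] at hx' ⊢
      exact ⟨by omega, hlow (show (x', y) ≤ (x, y) from ⟨hx, le_rfl⟩) hx'.2⟩
  have hcK : ∀ y, c y ≤ K := fun y => (Finset.card_filter_le _ _).trans (by simp)
  have hcol : ∀ x y, (x, y) ∈ S ↔ y < columnHeight c x := fun x y => by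
    have hb : columnHeight c x = ((Finset.range k).filter fun y => (x, y) ∈ S).card := by
      rw [columnHeight, ← Finset.card_map Fin.valEmbedding]
      congr 1
      ext y
      simp only [Finset.mem_map, Finset.mem_filter, Finset.mem_univ, true_and, Finset.mem_range,
        hmem, Fin.valEmbedding_apply, hcdef]
      constructor
      · rintro ⟨z, hz, rfl⟩; exact ⟨z.2, hz⟩
      · rintro ⟨hy, hz⟩; exact ⟨⟨y, hy⟩, hz, rfl⟩
    rw [hb, ← mem_iff_lt_card_of_isLowerSet]
    · simp only [Finset.mem_filter, Finset.mem_range]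
      exact ⟨fun h => ⟨(hS _ h).2, h⟩, fun h => h.2⟩
    · intro y y' hy hy'
      simp only [Finset.coe_filter, Finset.mem_range, Set.mem_ofPred_eq] at hy' ⊢
      exact ⟨by omega, hlow (show (x, y') ≤ (x, y) from ⟨le_rfl, hy⟩) hy'.2⟩
  have hrow : ∀ p, p ∈ S ↔ p.2 ∈ Finset.range k ∧ p.1 ∈ Finset.range (r p.2) := fun p => by
    rw [Finset.mem_range, Finset.mem_range, ← hmem]
    exact ⟨fun h => ⟨(hS _ h).2, h⟩, fun h => h.2⟩
  have hcol' : ∀ p, p ∈ S ↔ p.1 ∈ Finset.range K ∧ p.2 ∈ Finset.range (columnHeight c p.1) :=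
    fun p => by
      rw [Finset.mem_range, Finset.mem_range, ← hcol]
      exact ⟨fun h => ⟨(hS _ h).1, h⟩, fun h => h.2⟩
  have hcard : S.card = ∑ y, c y := by
    rw [Finset.card_eq_sum_ones, Finset.sum_finset_product_right S (Finset.range k)
      (fun y => Finset.range (r y)) hrow, Finset.sum_range]
    simp [hcdef]
  have hX : 2 * ∑ p ∈ S, (p.1 : ℚ) = (∑ y, c y ^ 2 : ℕ) - (∑ y, c y : ℕ) := by
    rw [Finset.sum_finset_product_right S (Finset.range k) (fun y => Finset.range (r y)) hrow,
      Finset.mul_sum, Finset.sum_range]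
    push_cast
    rw [← Finset.sum_sub_distrib]
    exact Finset.sum_congr rfl fun y _ => two_mul_sum_range_cast _
  have hY : 2 * ∑ p ∈ S, (p.2 : ℚ) =
      (∑ x ∈ Finset.range K, columnHeight c x ^ 2 : ℕ) - (∑ y, c y : ℕ) := by
    rw [Finset.sum_finset_product S (Finset.range K) (fun x => Finset.range (columnHeight c x))
      hcol', Finset.mul_sum, ← sum_columnHeight c hcK]
    push_cast
    rw [← Finset.sum_sub_distrib]
    exact Finset.sum_congr rfl fun y _ => two_mul_sum_range_cast _
  have := weighted_sum_sq_le c hk hcK h₁ h₁₂ hw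
  rw [← hX, ← hY] at this
  rw [Finset.sum_add_distrib, ← Finset.mul_sum, ← Finset.mul_sum, hcard]
  linarith

/-! ### Lexicographic segments, slices and compression -/

section LexInitial

variable {d : ℕ} {k : Fin d → ℕ}

/-- The points that agree with `z` outside the coordinates in `I`. -/
def box (I : Finset (Fin d)) (z : ∀ i, Fin (k i)) : Finset (∀ i, Fin (k i)) :=
  Finset.univ.filter fun x => ∀ i, i ∉ I → x i = z i

theorem mem_box {I : Finset (Fin d)} {z x : ∀ i, Fin (k i)} :
    x ∈ box I z ↔ ∀ i, i ∉ I → x i = z i := by simp [box]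

theorem update_mem_box {I : Finset (Fin d)} {z x : ∀ i, Fin (k i)} (hx : x ∈ box I z)
    {i : Fin d} (hi : i ∈ I) (t : Fin (k i)) : Function.update x i t ∈ box I z :=
  mem_box.2 fun j hj => by
    rw [Function.update_of_ne (by rintro rfl; exact hj hi)]
    exact mem_box.1 hx j hj

theorem mem_box_erase {I : Finset (Fin d)} {z x : ∀ i, Fin (k i)} {i : Fin d} (hi : i ∈ I)
    {t : Fin (k i)} : x ∈ box (I.erase i) (Function.update z i t) ↔ x ∈ box I z ∧ x i = t := by
  simp only [mem_box, Finset.mem_erase, not_and_or, not_not]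
  constructor
  · intro h
    refine ⟨fun j hj => ?_, by simpa using h i (Or.inl rfl)⟩
    rw [h j (Or.inr hj), Function.update_of_ne (by rintro rfl; exact hj hi)]
  · rintro ⟨h, rfl⟩ j hj
    rcases eq_or_ne j i with rfl | hji
    · simp
    · rw [Function.update_of_ne hji]
      exact h j (hj.resolve_left hji)

theorem toLex_lt_iff {x y : ∀ i, Fin (k i)} :
    toLex x < toLex y ↔ ∃ i, (∀ j, j < i → x j = y j) ∧ x i < y i := Iff.rfl

theorem toLex_update_lt {x y : ∀ i, Fin (k i)} {i : Fin d} (h : x i = y i) (t : Fin (k i))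
    (hxy : toLex x < toLex y) : toLex (Function.update x i t) < toLex (Function.update y i t) := by
  obtain ⟨j, hj, hlt⟩ := toLex_lt_iff.1 hxy
  have hji : j ≠ i := by rintro rfl; exact hlt.ne h
  refine toLex_lt_iff.2 ⟨j, fun l hl => ?_, by simpa [hji] using hlt⟩
  rcases eq_or_ne l i with rfl | hli
  · simp
  · simpa [hli] using hj l hl

theorem toLex_update_self_lt {x : ∀ i, Fin (k i)} {i : Fin d} {t : Fin (k i)} :
    t < x i → toLex (Function.update x i t) < toLex x := fun h =>
  toLex_lt_iff.2 ⟨i, fun j hj => by rw [Function.update_of_ne hj.ne], by simpa using h⟩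

/-- `T` is an initial segment of `B` in the lexicographic order. -/
def LexInitial (B T : Finset (∀ i, Fin (k i))) : Prop :=
  T ⊆ B ∧ ∀ x ∈ T, ∀ y ∈ B, toLex y < toLex x → y ∈ T

theorem LexInitial.subset_of_card_le {B T U : Finset (∀ i, Fin (k i))} (hT : LexInitial B T)
    (hU : LexInitial B U) (h : T.card ≤ U.card) : T ⊆ U := by
  by_contra hn
  obtain ⟨x, hxT, hxU⟩ := Finset.not_subset.1 hn
  have : U ⊆ T := fun y hy => by
    rcases lt_trichotomy (toLex y) (toLex x) with hlt | heq | hgt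
    · exact hT.2 x hxT y (hU.1 hy) hlt
    · rwa [toLex_inj.1 heq]
    · exact absurd (hU.2 y hy x (hT.1 hxT) hgt) hxU
  rw [Finset.eq_of_subset_of_card_le this h] at hxU
  exact hxU hxT

theorem LexInitial.eq_of_card_eq {B T U : Finset (∀ i, Fin (k i))} (hT : LexInitial B T)
    (hU : LexInitial B U) (h : T.card = U.card) : T = U :=
  Finset.eq_of_subset_of_card_le (hT.subset_of_card_le hU h.le) h.ge

theorem exists_lexInitial (B : Finset (∀ i, Fin (k i))) {n : ℕ} (hn : n ≤ B.card) :
    ∃ T, LexInitial B T ∧ T.card = n := by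
  induction n with
  | zero => exact ⟨∅, ⟨by simp, by simp⟩, rfl⟩
  | succ n ih =>
    obtain ⟨T, hT, hcard⟩ := ih (by omega)
    have hne : (B \ T).Nonempty := by
      rw [← Finset.card_pos, Finset.card_sdiff_of_subset hT.1]; omega
    obtain ⟨x, hx, hmin⟩ := Finset.exists_min_image (B \ T) toLex hne
    rw [Finset.mem_sdiff] at hx
    refine ⟨insert x T, ⟨Finset.insert_subset hx.1 hT.1, fun y hy w hw hwy => ?_⟩, by
      rw [Finset.card_insert_of_notMem hx.2, hcard]⟩
    rw [Finset.mem_insert] at hy ⊢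
    right
    rcases hy with rfl | hy
    · by_contra hwT
      exact absurd (hmin w (Finset.mem_sdiff.2 ⟨hw, hwT⟩)) (not_le.2 hwy)
    · exact hT.2 y hy w hw hwy

open Classical in
/-- The number of points below `x` in the lexicographic order. -/
noncomputable def lexRank (x : ∀ i, Fin (k i)) : ℕ := (Finset.univ.filter fun y => toLex y < toLex x).card

theorem lexRank_lt {x y : ∀ i, Fin (k i)} (h : toLex x < toLex y) : lexRank x < lexRank y := by
  refine Finset.card_lt_card (Finset.ssubset_iff_of_subset (fun z hz => ?_) |>.2 ⟨x, ?_, ?_⟩)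
  · simp only [Finset.mem_filter, Finset.mem_univ, true_and] at hz ⊢
    exact hz.trans h
  · simpa using h
  · simp only [Finset.mem_filter, not_and]
    exact fun _ => lt_irrefl (toLex x)

/-- Every point of `T \ S` precedes every point of `S \ T`. The strict decrease makes the rank sum a
termination measure. -/
theorem LexInitial.sum_lexRank_lt {B T S : Finset (∀ i, Fin (k i))} (hT : LexInitial B T)
    (hS : S ⊆ B) (h : S.card = T.card) (hne : S ≠ T) :
    ∑ x ∈ T, lexRank x < ∑ x ∈ S, lexRank x := by
  have hcard : (S \ T).card = (T \ S).card := Finset.card_sdiff_comm h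
  have hpos : (T \ S).Nonempty := by
    rw [Finset.sdiff_nonempty]
    intro hTS
    exact hne (Finset.eq_of_subset_of_card_le hTS h.le).symm
  obtain ⟨m, hm, hmax⟩ := Finset.exists_max_image (T \ S) lexRank hpos
  rw [← Finset.sum_sdiff (Finset.inter_subset_left : T ∩ S ⊆ T),
    ← Finset.sum_sdiff (Finset.inter_subset_left : S ∩ T ⊆ S), Finset.inter_comm,
    Finset.sdiff_inter_self_right, Finset.inter_comm S T, Finset.sdiff_inter_self_right]
  refine Nat.add_lt_add_right ?_ _
  have h1 := Finset.sum_le_card_nsmul (T \ S) lexRank (lexRank m) hmax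
  have h2 := Finset.card_nsmul_le_sum (S \ T) lexRank (lexRank m + 1) fun x hx => by
    rw [Finset.mem_sdiff] at hx hm
    refine lexRank_lt ?_
    rcases lt_trichotomy (toLex m) (toLex x) with hlt | heq | hgt
    · exact hlt
    · rw [toLex_inj.1 heq] at hm; exact absurd hx.1 hm.2
    · exact absurd (hT.2 m hm.1 x (hS hx.1) hgt) hx.2
  rw [hcard] at h2
  simp only [smul_eq_mul] at h1 h2
  have := hpos.card_pos
  nlinarith

/-- The number of pairs of a point in `S` and a point outside `S` that differ in
coordinate `i` only. -/
def cutDir (i : Fin d) (S : Finset (∀ i, Fin (k i))) : ℕ :=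
  ∑ x ∈ S, (Finset.univ.filter fun t => Function.update x i t ∉ S).card

/-- The weighted sum of the cuts in the directions of `I`. -/
def weightedCut (w : Fin d → ℚ) (I : Finset (Fin d)) (S : Finset (∀ i, Fin (k i))) : ℚ :=
  ∑ i ∈ I, w i * cutDir i S

/-- The part of `S` where coordinate `i` has the value `t`. -/
def slice (i : Fin d) (t : Fin (k i)) (S : Finset (∀ i, Fin (k i))) : Finset (∀ i, Fin (k i)) :=
  S.filter fun x => x i = t

theorem mem_slice {i : Fin d} {t : Fin (k i)} {S : Finset (∀ i, Fin (k i))} {x : ∀ i, Fin (k i)} :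
    x ∈ slice i t S ↔ x ∈ S ∧ x i = t := Finset.mem_filter

theorem sum_slice {M : Type*} [AddCommMonoid M] (i : Fin d) (S : Finset (∀ i, Fin (k i)))
    (f : (∀ i, Fin (k i)) → M) : ∑ t, ∑ x ∈ slice i t S, f x = ∑ x ∈ S, f x :=
  Finset.sum_fiberwise S (fun x => x i) f

theorem slice_subset {I : Finset (Fin d)} {z : ∀ i, Fin (k i)} {i : Fin d} (hi : i ∈ I)
    {S : Finset (∀ i, Fin (k i))} (hS : S ⊆ box I z) (t : Fin (k i)) :
    slice i t S ⊆ box (I.erase i) (Function.update z i t) := fun _ hx =>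
  (mem_box_erase hi).2 ⟨hS (mem_slice.1 hx).1, (mem_slice.1 hx).2⟩

theorem cutDir_eq_sum_slice {i j : Fin d} (hij : j ≠ i) (S : Finset (∀ i, Fin (k i))) :
    cutDir j S = ∑ t, cutDir j (slice i t S) := by
  rw [cutDir, ← sum_slice i S]
  refine Finset.sum_congr rfl fun t _ => Finset.sum_congr rfl fun x hx => ?_
  congr 1
  ext s
  simp [mem_slice, Function.update_of_ne hij.symm, (mem_slice.1 hx).2]

theorem weightedCut_eq_add_sum_slice (w : Fin d → ℚ) {I : Finset (Fin d)} {i : Fin d} (hi : i ∈ I)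
    (S : Finset (∀ i, Fin (k i))) :
    weightedCut w I S = w i * cutDir i S + ∑ t, weightedCut w (I.erase i) (slice i t S) := by
  rw [weightedCut, ← Finset.add_sum_erase _ _ hi]
  congr 1
  simp only [weightedCut]
  rw [Finset.sum_comm]
  refine Finset.sum_congr rfl fun j hj => ?_
  rw [cutDir_eq_sum_slice (Finset.ne_of_mem_erase hj) S, Nat.cast_sum, Finset.mul_sum]

theorem cutDir_eq_sum_sum (i : Fin d) (S : Finset (∀ i, Fin (k i))) :
    cutDir i S = ∑ s, ∑ t, ((slice i s S).filter fun x => Function.update x i t ∉ S).card := by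
  rw [cutDir, ← sum_slice i S]
  refine Finset.sum_congr rfl fun s _ => ?_
  simp_rw [Finset.card_filter]
  rw [Finset.sum_comm]

/-- Translation from slice `s` to slice `t` is injective, so at most `(slice i t S).card` points of
slice `s` stay in `S`. -/
theorem sum_card_slice_sub_le_cutDir (i : Fin d) (S : Finset (∀ i, Fin (k i))) :
    ∑ s, ∑ t, ((slice i s S).card - (slice i t S).card) ≤ cutDir i S := by
  rw [cutDir_eq_sum_sum]
  refine Finset.sum_le_sum fun s _ => Finset.sum_le_sum fun t _ => ?_
  rw [← Finset.card_filter_add_card_filter_not (s := slice i s S)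
    (fun x => Function.update x i t ∉ S)]
  have : ((slice i s S).filter fun x => ¬ Function.update x i t ∉ S).card ≤ (slice i t S).card := by
    refine Finset.card_le_card_of_injOn (fun x => Function.update x i t) (fun x hx => ?_) ?_
    · have := (Finset.mem_filter.1 hx).2
      exact mem_slice.2 ⟨not_not.1 this, by simp⟩
    · intro x hx y hy hxy
      have hx := (mem_slice.1 (Finset.mem_filter.1 hx).1).2
      have hy := (mem_slice.1 (Finset.mem_filter.1 hy).1).2
      funext j
      rcases eq_or_ne j i with rfl | hj
      · rw [hx, hy]
      · simpa [hj] using congrFun hxy j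
  omega

/-- The set whose slices in direction `i` are given. -/
def ofSlices (i : Fin d) (T : Fin (k i) → Finset (∀ i, Fin (k i))) : Finset (∀ i, Fin (k i)) :=
  Finset.univ.filter fun x => x ∈ T (x i)

theorem mem_ofSlices {i : Fin d} {T : Fin (k i) → Finset (∀ i, Fin (k i))}
    {x : ∀ i, Fin (k i)} : x ∈ ofSlices i T ↔ x ∈ T (x i) := by simp [ofSlices]

theorem slice_ofSlices {i : Fin d} {T : Fin (k i) → Finset (∀ i, Fin (k i))}
    (hT : ∀ t, ∀ x ∈ T t, x i = t) (t : Fin (k i)) : slice i t (ofSlices i T) = T t := by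
  ext x
  rw [mem_slice, mem_ofSlices]
  constructor
  · rintro ⟨h, rfl⟩; exact h
  · intro h; rw [hT t x h]; exact ⟨h, rfl⟩

/-- Translates of initial slices are initial, and initial segments of one box are nested, so the
lower bound of `sum_card_slice_sub_le_cutDir` is attained. -/
theorem cutDir_ofSlices_le {I : Finset (Fin d)} {z : ∀ i, Fin (k i)} {i : Fin d} (hi : i ∈ I)
    {T : Fin (k i) → Finset (∀ i, Fin (k i))}
    (hT : ∀ t, LexInitial (box (I.erase i) (Function.update z i t)) (T t)) :
    cutDir i (ofSlices i T) ≤ ∑ s, ∑ t, ((T s).card - (T t).card) := by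
  have hTi : ∀ t, ∀ x ∈ T t, x i = t := fun t x hx => ((mem_box_erase hi).1 ((hT t).1 hx)).2
  rw [cutDir_eq_sum_sum]
  refine Finset.sum_le_sum fun s _ => Finset.sum_le_sum fun t _ => ?_
  rw [slice_ofSlices hTi]
  have hinj : Set.InjOn (fun x : ∀ i, Fin (k i) => Function.update x i s) (T t) := by
    intro x hx y hy hxy
    funext j
    rcases eq_or_ne j i with rfl | hj
    · rw [hTi t x hx, hTi t y hy]
    · simpa [hj] using congrFun hxy j
  set U := (T t).image fun x => Function.update x i s with hU
  have hUcard : U.card = (T t).card := Finset.card_image_of_injOn hinj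
  have hmemU : ∀ x, x i = s → (x ∈ U ↔ Function.update x i t ∈ T t) := fun x hx => by
    rw [hU, Finset.mem_image]
    constructor
    · rintro ⟨y, hy, rfl⟩
      have : Function.update y i t = y := by rw [← hTi t y hy, Function.update_eq_self]
      simpa [this] using hy
    · intro h
      exact ⟨_, h, by simp [← hx]⟩
  have hUinit : LexInitial (box (I.erase i) (Function.update z i s)) U := by
    constructor
    · intro x hx
      obtain ⟨y, hy, rfl⟩ := Finset.mem_image.1 hx
      have := (mem_box_erase hi).1 ((hT t).1 hy)
      exact (mem_box_erase hi).2 ⟨update_mem_box this.1 hi s, by simp⟩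
    · intro x hx y hy hyx
      have hxi : x i = s := by
        obtain ⟨x', _, rfl⟩ := Finset.mem_image.1 hx
        simp
      have hyi := ((mem_box_erase hi).1 hy).2
      rw [hmemU y hyi]
      rw [hmemU x hxi] at hx
      refine (hT t).2 _ hx _ ?_ (toLex_update_lt (hyi.trans hxi.symm) t hyx)
      exact (mem_box_erase hi).2 ⟨update_mem_box ((mem_box_erase hi).1 hy).1 hi t, by simp⟩
  have heq : ((T s).filter fun x => Function.update x i t ∉ ofSlices i T) = T s \ U := by
    ext x
    rw [Finset.mem_filter, Finset.mem_sdiff]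
    refine and_congr_right fun hx => ?_
    rw [hmemU x (hTi s x hx), mem_ofSlices]
    simp
  rw [heq, ← hUcard]
  rcases le_total (T s).card U.card with h | h
  · rw [Finset.sdiff_eq_empty_iff_subset.2 ((hT s).subset_of_card_le hUinit h)]; simp
  · rw [Finset.card_sdiff_of_subset (hUinit.subset_of_card_le (hT s) h)]

/-- The compression step: unless all slices in direction `i` are initial segments, `S` can be
replaced by a set of smaller rank sum with no larger cut. -/
theorem exists_compression {w : Fin d → ℚ} (hw : ∀ i, 0 ≤ w i) {I : Finset (Fin d)}
    {z : ∀ i, Fin (k i)} {i : Fin d} (hi : i ∈ I)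
    (ih : ∀ (t : Fin (k i)) (T S : Finset (∀ i, Fin (k i))),
      LexInitial (box (I.erase i) (Function.update z i t)) T →
      S ⊆ box (I.erase i) (Function.update z i t) → S.card = T.card →
      weightedCut w (I.erase i) T ≤ weightedCut w (I.erase i) S)
    {S : Finset (∀ i, Fin (k i))} (hS : S ⊆ box I z)
    (hn : ¬ ∀ t, LexInitial (box (I.erase i) (Function.update z i t)) (slice i t S)) :
    ∃ S' ⊆ box I z, S'.card = S.card ∧ weightedCut w I S' ≤ weightedCut w I S ∧
      ∑ x ∈ S', lexRank x < ∑ x ∈ S, lexRank x := by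
  have hex : ∀ t, ∃ T, LexInitial (box (I.erase i) (Function.update z i t)) T ∧
      T.card = (slice i t S).card := fun t =>
    exists_lexInitial _ (Finset.card_le_card (slice_subset hi hS t))
  choose T hT hcard using hex
  have hTi : ∀ t, ∀ x ∈ T t, x i = t := fun t x hx => ((mem_box_erase hi).1 ((hT t).1 hx)).2
  refine ⟨ofSlices i T, fun x hx => ?_, ?_, ?_, ?_⟩
  · exact ((mem_box_erase hi).1 ((hT _).1 (mem_ofSlices.1 hx))).1
  · rw [Finset.card_eq_sum_ones, Finset.card_eq_sum_ones, ← sum_slice i, ← sum_slice i S]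
    simp_rw [slice_ofSlices hTi, Finset.sum_const, smul_eq_mul, hcard]
  · rw [weightedCut_eq_add_sum_slice w hi, weightedCut_eq_add_sum_slice w hi S]
    refine add_le_add (mul_le_mul_of_nonneg_left ?_ (hw i)) (Finset.sum_le_sum fun t _ => ?_)
    · have h1 := cutDir_ofSlices_le hi hT
      simp_rw [hcard] at h1
      exact_mod_cast h1.trans (sum_card_slice_sub_le_cutDir i S)
    · rw [slice_ofSlices hTi]
      exact ih t _ _ (hT t) (slice_subset hi hS t) (hcard t).symm
  · rw [← sum_slice i, ← sum_slice i S]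
    simp_rw [slice_ofSlices hTi]
    obtain ⟨t, ht⟩ := not_forall.1 hn
    refine Finset.sum_lt_sum (fun s _ => ?_) ⟨t, Finset.mem_univ _, ?_⟩
    · rcases eq_or_ne (slice i s S) (T s) with h | h
      · rw [h]
      · exact ((hT s).sum_lexRank_lt (slice_subset hi hS s) (hcard s).symm h).le
    · refine (hT t).sum_lexRank_lt (slice_subset hi hS t) (hcard t).symm ?_
      intro h
      rw [h] at ht
      exact ht (hT t)

theorem cutDir_eq_of_closed {i : Fin d} {S : Finset (∀ i, Fin (k i))}
    (hS : ∀ x ∈ S, ∀ t, t ≤ x i → Function.update x i t ∈ S) :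
    (cutDir i S : ℚ) = ∑ x ∈ S, ((k i : ℚ) - 1 - 2 * (x i : ℕ)) := by
  have h1 : ∀ x ∈ S, (Finset.univ.filter fun t => Function.update x i t ∉ S).card +
      ((Finset.Ioi (x i)).filter fun t => Function.update x i t ∈ S).card + x i + 1 = k i := by
    intro x hx
    have e : (Finset.univ.filter fun t => Function.update x i t ∉ S) =
        (Finset.Ioi (x i)).filter fun t => ¬ Function.update x i t ∈ S := by
      ext t
      simp only [Finset.mem_filter, Finset.mem_univ, true_and, Finset.mem_Ioi]
      exact ⟨fun h => ⟨not_le.1 fun ht => h (hS x hx t ht), h⟩, fun h => h.2⟩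
    have := Finset.card_filter_add_card_filter_not (s := Finset.Ioi (x i))
      (fun t => Function.update x i t ∈ S)
    rw [Fin.card_Ioi] at this
    have := (x i).2
    rw [e]; omega
  -- Pairs inside `S` on a common line, counted from the lower and from the upper point; by
  -- closedness the upper point `x` has exactly `x i` partners below.
  have h2 : ∑ x ∈ S, ((Finset.Ioi (x i)).filter fun t => Function.update x i t ∈ S).card =
      ∑ x ∈ S, (x i : ℕ) := by
    have e : ∀ x ∈ S, (x i : ℕ) =
        ((Finset.Iio (x i)).filter fun t => Function.update x i t ∈ S).card := fun x hx => by
      rw [Finset.filter_true_of_mem fun t ht => hS x hx t (Finset.mem_Iio.1 ht).le, Fin.card_Iio]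
    rw [Finset.sum_congr rfl e, ← Finset.card_sigma, ← Finset.card_sigma]
    refine Finset.card_bij' (fun p _ => ⟨Function.update p.1 i p.2, p.1 i⟩)
      (fun p _ => ⟨Function.update p.1 i p.2, p.1 i⟩) ?_ ?_ ?_ ?_
    · rintro ⟨x, t⟩ hp
      simp only [Finset.mem_sigma, Finset.mem_filter, Finset.mem_Ioi, Finset.mem_Iio] at hp ⊢
      simpa using ⟨hp.2.2, hp.2.1, hp.1⟩
    · rintro ⟨x, t⟩ hp
      simp only [Finset.mem_sigma, Finset.mem_filter, Finset.mem_Ioi, Finset.mem_Iio] at hp ⊢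
      simpa using ⟨hp.2.2, hp.2.1, hp.1⟩
    · rintro ⟨x, t⟩ _; simp
    · rintro ⟨x, t⟩ _; simp
  have h3 := Finset.sum_congr (rfl : S = S) h1
  rw [Finset.sum_add_distrib, Finset.sum_add_distrib, Finset.sum_add_distrib, h2,
    ← cutDir] at h3
  have h4 : (cutDir i S : ℚ) + ∑ x ∈ S, ((x i : ℕ) : ℚ) + ∑ x ∈ S, ((x i : ℕ) : ℚ) + S.card =
      S.card * k i := by
    simp only [Finset.sum_const, smul_eq_mul, mul_one] at h3
    exact_mod_cast h3
  rw [Finset.sum_sub_distrib, ← Finset.mul_sum, Finset.sum_const, nsmul_eq_mul]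
  linarith

/-- `S` is closed under lowering a coordinate in `I`. -/
def CoordClosed (I : Finset (Fin d)) (S : Finset (∀ i, Fin (k i))) : Prop :=
  ∀ i ∈ I, ∀ x ∈ S, ∀ t, t ≤ x i → Function.update x i t ∈ S

theorem weightedCut_eq_of_closed (w : Fin d → ℚ) {I : Finset (Fin d)}
    {S : Finset (∀ i, Fin (k i))} (hS : CoordClosed I S) :
    weightedCut w I S = ∑ x ∈ S, ∑ i ∈ I, w i * ((k i : ℚ) - 1 - 2 * (x i : ℕ)) := by
  rw [Finset.sum_comm, weightedCut]
  exact Finset.sum_congr rfl fun i hi => by rw [cutDir_eq_of_closed (hS i hi), Finset.mul_sum]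

theorem LexInitial.coordClosed {I : Finset (Fin d)} {z : ∀ i, Fin (k i)}
    {T : Finset (∀ i, Fin (k i))} (hT : LexInitial (box I z) T) : CoordClosed I T :=
  fun i hi x hx t ht => by
    rcases ht.eq_or_lt with rfl | ht
    · rwa [Function.update_eq_self]
    · exact hT.2 x hx _ (update_mem_box (hT.1 hx) hi t) (toLex_update_self_lt ht)

end LexInitial

/-! ### Lexicographic segments minimize the weighted cut -/

section LexOptimal

variable {d : ℕ} {k : Fin d → ℕ}

theorem weightedCut_singleton {i : Fin d} {z : ∀ i, Fin (k i)} {S : Finset (∀ i, Fin (k i))}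
    (hS : S ⊆ box {i} z) (w : Fin d → ℚ) :
    weightedCut w {i} S = w i * (S.card * (k i - S.card : ℕ) : ℕ) := by
  rw [weightedCut, Finset.sum_singleton, cutDir, Finset.sum_congr rfl (g := fun _ => k i - S.card),
    Finset.sum_const, smul_eq_mul]
  intro x hx
  have h := Finset.card_filter_add_card_filter_not (s := (Finset.univ : Finset (Fin (k i))))
      (fun t => Function.update x i t ∈ S)
  have h2 : (Finset.univ.filter fun t => Function.update x i t ∈ S).card = S.card := by
    refine Finset.card_bij (fun t _ => Function.update x i t) (fun t ht => by simpa using ht)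
      (fun t _ s _ hts => Function.update_injective x i hts) fun y hy => ⟨y i, ?_, ?_⟩
    all_goals
      have : Function.update x i (y i) = y := by
        funext j
        rcases eq_or_ne j i with rfl | hj
        · simp
        · rw [Function.update_of_ne hj, mem_box.1 (hS hx) j (by simpa using hj),
            mem_box.1 (hS hy) j (by simpa using hj)]
      simp [this, hy]
  rw [h2, Finset.card_univ, Fintype.card_fin] at h
  omega

theorem weightedCut_pair_le {w : Fin d → ℚ} {i₁ i₂ : Fin d} (hi : i₁ < i₂) (h₁ : 0 ≤ w i₁)
    (h₁₂ : w i₁ ≤ w i₂)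
    (hw : k i₁ ≤ k i₂ ∨ w i₁ * ((k i₁ : ℚ) ^ 2 - 1) ≤ w i₂ * (k i₂ : ℚ) ^ 2)
    {z : ∀ i, Fin (k i)} {S T : Finset (∀ i, Fin (k i))}
    (hT : LexInitial (box {i₁, i₂} z) T) (hS : S ⊆ box {i₁, i₂} z) (hcl : CoordClosed {i₁, i₂} S)
    (hcard : S.card = T.card) : weightedCut w {i₁, i₂} T ≤ weightedCut w {i₁, i₂} S := by
  have hk : 0 < k i₂ := (z i₂).pos
  have hext : ∀ x ∈ box {i₁, i₂} z, ∀ y ∈ box {i₁, i₂} z, x i₁ = y i₁ → x i₂ = y i₂ → x = y := by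
    intro x hx y hy e1 e2
    funext j
    by_cases hj : j ∈ ({i₁, i₂} : Finset (Fin d))
    · rcases Finset.mem_insert.1 hj with rfl | hj
      · exact e1
      · rw [Finset.mem_singleton.1 hj]; exact e2
    · rw [mem_box.1 hx j hj, mem_box.1 hy j hj]
  have hm1 : i₁ ∈ ({i₁, i₂} : Finset (Fin d)) := by simp
  have hm2 : i₂ ∈ ({i₁, i₂} : Finset (Fin d)) := by simp
  have hform : ∀ U : Finset (∀ i, Fin (k i)), CoordClosed {i₁, i₂} U →
      weightedCut w {i₁, i₂} U = U.card * (w i₁ * (k i₁ - 1) + w i₂ * (k i₂ - 1)) -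
        2 * ∑ x ∈ U, (w i₁ * (x i₁ : ℕ) + w i₂ * (x i₂ : ℕ)) := by
    intro U hU
    rw [weightedCut_eq_of_closed w hU, Finset.mul_sum, ← nsmul_eq_mul, ← Finset.sum_const,
      ← Finset.sum_sub_distrib]
    refine Finset.sum_congr rfl fun x _ => ?_
    rw [Finset.sum_pair hi.ne]; ring
  have hSsum : ∑ x ∈ S, (w i₁ * (x i₁ : ℕ) + w i₂ * (x i₂ : ℕ)) ≤
      ∑ m ∈ Finset.range S.card, (w i₁ * (m / k i₂ : ℕ) + w i₂ * (m % k i₂ : ℕ)) := by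
    have hinj : Set.InjOn (fun x : ∀ i, Fin (k i) => ((x i₁ : ℕ), (x i₂ : ℕ))) S := by
      intro x hx y hy hxy
      simp only [Prod.mk.injEq, Fin.val_inj] at hxy
      exact hext x (hS hx) y (hS hy) hxy.1 hxy.2
    have := weighted_sum_le_of_isLowerSet (K := k i₁) hk
      (S.image fun x => ((x i₁ : ℕ), (x i₂ : ℕ))) (fun p hp => by
        obtain ⟨x, _, rfl⟩ := Finset.mem_image.1 hp
        exact ⟨(x i₁).2, (x i₂).2⟩) (fun p q hqp hp => by
        obtain ⟨x, hx, rfl⟩ := Finset.mem_image.1 (Finset.mem_coe.1 hp)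
        obtain ⟨q1, q2⟩ := q
        have hq1 : q1 ≤ x i₁ := hqp.1
        have hq2 : q2 ≤ x i₂ := hqp.2
        refine Finset.mem_coe.2 (Finset.mem_image.2
          ⟨Function.update (Function.update x i₁ ⟨q1, by omega⟩) i₂ ⟨q2, by omega⟩,
            hcl i₂ hm2 _ (hcl i₁ hm1 x hx _ hq1) _ ?_, ?_⟩)
        · rw [Function.update_of_ne hi.ne']; exact hq2
        · simp [Function.update_of_ne hi.ne]) h₁ h₁₂ hw
    rwa [Finset.sum_image hinj, Finset.card_image_of_injOn hinj] at this
  have hTsum : ∑ x ∈ T, (w i₁ * (x i₁ : ℕ) + w i₂ * (x i₂ : ℕ)) =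
      ∑ m ∈ Finset.range T.card, (w i₁ * (m / k i₂ : ℕ) + w i₂ * (m % k i₂ : ℕ)) := by
    have hdiv : ∀ x : ∀ i, Fin (k i), ((x i₁ : ℕ) * k i₂ + x i₂) / k i₂ = x i₁ := fun x => by
      rw [mul_comm, Nat.mul_add_div hk, Nat.div_eq_of_lt (x i₂).2, add_zero]
    have hmod : ∀ x : ∀ i, Fin (k i), ((x i₁ : ℕ) * k i₂ + x i₂) % k i₂ = x i₂ := fun x => by
      rw [mul_comm, Nat.mul_add_mod, Nat.mod_eq_of_lt (x i₂).2]
    have hinj : Set.InjOn (fun x : ∀ i, Fin (k i) => (x i₁ : ℕ) * k i₂ + x i₂) T := by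
      intro x hx y hy hxy
      dsimp only at hxy
      refine hext x (hT.1 hx) y (hT.1 hy) (Fin.ext ?_) (Fin.ext ?_)
      · rw [← hdiv x, ← hdiv y, hxy]
      · rw [← hmod x, ← hmod y, hxy]
    -- The code `x i₁ * k i₂ + x i₂` is the position in lexicographic order, so an initial segment
    -- is coded by an initial interval.
    have himg : T.image (fun x : ∀ i, Fin (k i) => (x i₁ : ℕ) * k i₂ + x i₂) =
        Finset.range T.card := by
      ext m
      rw [mem_iff_lt_card_of_isLowerSet, Finset.card_image_of_injOn hinj, Finset.mem_range]
      intro a n hna ha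
      obtain ⟨x, hx, rfl⟩ := Finset.mem_image.1 (Finset.mem_coe.1 ha)
      rcases hna.eq_or_lt with rfl | hna
      · exact ha
      have hle : n / k i₂ ≤ x i₁ := by
        rw [← hdiv x]; exact Nat.div_le_div_right hna.le
      have hnm := Nat.div_add_mod' n (k i₂)
      refine Finset.mem_coe.2 (Finset.mem_image.2
        ⟨Function.update (Function.update x i₁ ⟨n / k i₂, hle.trans_lt (x i₁).2⟩) i₂
          ⟨n % k i₂, Nat.mod_lt _ hk⟩, hT.2 x hx _ ?_ ?_, ?_⟩)
      · exact update_mem_box (update_mem_box (hT.1 hx) hm1 _) hm2 _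
      · rcases hle.eq_or_lt with he | hlt
        · refine toLex_lt_iff.2 ⟨i₂, fun j hj => ?_, ?_⟩
          · rw [Function.update_of_ne hj.ne]
            rcases eq_or_ne j i₁ with rfl | hj1
            · rw [Function.update_self]; exact Fin.ext he
            · rw [Function.update_of_ne hj1]
          · rw [Function.update_self, Fin.lt_def]
            rw [he] at hnm
            simp only; omega
        · refine toLex_lt_iff.2 ⟨i₁, fun j hj => ?_, ?_⟩
          · rw [Function.update_of_ne (hj.trans hi).ne, Function.update_of_ne hj.ne]
          · rw [Function.update_of_ne hi.ne, Function.update_self]; exact hlt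
      · simpa [Function.update_of_ne hi.ne] using hnm
    rw [← himg, Finset.sum_image hinj]
    exact Finset.sum_congr rfl fun x _ => by rw [hdiv, hmod]
  rw [hform S hcl, hform T hT.coordClosed, hTsum, ← hcard]
  linarith

/-- In at least three directions, a set with initial slices that is not itself initial can be
improved by exchanging its last element for the first missing one. -/
theorem exists_improving_swap {w : Fin d → ℚ} (hw0 : ∀ i, 0 ≤ w i) (hmono : ∀ i j, i < j → w i ≤ w j)
    (hk : ∀ i, 2 ≤ k i) {I : Finset (Fin d)} (hI : 3 ≤ I.card) {z : ∀ i, Fin (k i)}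
    {S : Finset (∀ i, Fin (k i))} (hS : S ⊆ box I z)
    (hsl : ∀ i ∈ I, ∀ x ∈ S, ∀ y ∈ box I z, y i = x i → toLex y < toLex x → y ∈ S)
    (hcl : CoordClosed I S) (hn : ¬ LexInitial (box I z) S) :
    ∃ S' ⊆ box I z, S'.card = S.card ∧ weightedCut w I S' ≤ weightedCut w I S ∧
      ∑ x ∈ S', lexRank x < ∑ x ∈ S, lexRank x := by
  obtain ⟨y₀, hy₀, x₀, hx₀, hlt₀, hx₀S⟩ : ∃ y ∈ S, ∃ x ∈ box I z, toLex x < toLex y ∧ x ∉ S := by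
    by_contra hcon
    push Not at hcon
    exact hn ⟨hS, fun y hy x hx hlt => hcon y hy x hx hlt⟩
  obtain ⟨x, hx, hxmin⟩ := Finset.exists_min_image (box I z \ S) toLex
    ⟨x₀, Finset.mem_sdiff.2 ⟨hx₀, hx₀S⟩⟩
  obtain ⟨y, hy, hymax⟩ := Finset.exists_max_image S toLex ⟨y₀, hy₀⟩
  have hxy : toLex x < toLex y :=
    (hxmin x₀ (Finset.mem_sdiff.2 ⟨hx₀, hx₀S⟩)).trans_lt (hlt₀.trans_le (hymax y₀ hy₀))
  obtain ⟨hxB, hxS⟩ := Finset.mem_sdiff.1 hx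
  have hyB := hS hy
  -- Here `x` is the first missing point and `y` the last point of `S`. A common coordinate would
  -- put them in one slice, which is initial. The next steps pin `x` and `y` down by chains through
  -- two slices that would otherwise force `x ∈ S`.
  have hne : ∀ i ∈ I, x i ≠ y i := fun i hi h => hxS (hsl i hi y hy x hxB h hxy)
  obtain ⟨i₁, hpre, hlt⟩ := toLex_lt_iff.1 hxy
  have hi₁ : i₁ ∈ I := by
    by_contra h
    rw [mem_box.1 hxB _ h, mem_box.1 hyB _ h] at hlt
    exact lt_irrefl _ hlt
  have hfirst : ∀ j ∈ I, j ≠ i₁ → i₁ < j := fun j hj hji => by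
    rcases lt_trichotomy j i₁ with h | h | h
    · exact absurd (hpre j h) (hne j hj)
    · exact absurd h hji
    · exact h
  have hlex : ∀ p q : ∀ i, Fin (k i), (∀ j, j < i₁ → p j = x j) → (∀ j, j < i₁ → q j = y j) →
      p i₁ < q i₁ → toLex p < toLex q := fun p q hp hq h =>
    toLex_lt_iff.2 ⟨i₁, fun j hj => by rw [hp j hj, hq j hj, hpre j hj], h⟩
  obtain ⟨i₂, hi₂, i₃, hi₃, h12, h23⟩ : ∃ i₂ ∈ I, ∃ i₃ ∈ I, i₁ < i₂ ∧ i₂ < i₃ := by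
    have hc : 1 < (I.erase i₁).card := by rw [Finset.card_erase_of_mem hi₁]; omega
    obtain ⟨a, ha, b, hb, hab⟩ := Finset.one_lt_card.1 hc
    rw [Finset.mem_erase] at ha hb
    rcases lt_or_gt_of_ne hab with h | h
    · exact ⟨a, ha.2, b, hb.2, hfirst a ha.2 ha.1, h⟩
    · exact ⟨b, hb.2, a, ha.2, hfirst b hb.2 hb.1, h⟩
  have h13 := h12.trans h23
  have hpos : ∀ i, 0 < k i := fun i => by have := hk i; omega
  have hd : ∀ j ∈ I, j ≠ i₁ → y j < x j := by
    intro j hj hj1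
    by_contra hcon
    have hij := hfirst j hj hj1
    have hle := not_lt.1 hcon
    refine hxS (hsl j hj (Function.update y j (x j)) (hcl j hj y hy _ hle) x hxB (by simp) ?_)
    refine hlex _ _ (fun _ _ => rfl) (fun l hl => ?_) ?_
    · rw [Function.update_of_ne (hl.trans hij).ne]
    · rwa [Function.update_of_ne hij.ne]
  have hqS : Function.update y i₃ ⟨0, hpos i₃⟩ ∈ S := hcl i₃ hi₃ y hy _ (Nat.zero_le _)
  have hb : (x i₂ : ℕ) + 1 = k i₂ := by
    by_contra hcon
    have hx2 : (x i₂ : ℕ) + 1 < k i₂ := by have := (x i₂).2; omega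
    set p := Function.update (Function.update x i₂ ⟨k i₂ - 1, by omega⟩) i₃ ⟨0, hpos i₃⟩ with hp
    have hpB : p ∈ box I z := update_mem_box (update_mem_box hxB hi₂ _) hi₃ _
    have hp1 : p i₁ = x i₁ := by
      rw [hp, Function.update_of_ne h13.ne, Function.update_of_ne h12.ne]
    have hpS : p ∈ S := by
      refine hsl i₃ hi₃ _ hqS p hpB (by simp [hp]) (hlex _ _ (fun j hj => ?_) (fun j hj => ?_) ?_)
      · rw [hp, Function.update_of_ne (hj.trans h13).ne, Function.update_of_ne (hj.trans h12).ne]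
      · rw [Function.update_of_ne (hj.trans h13).ne]
      · rwa [hp1, Function.update_of_ne h13.ne]
    refine hxS (hsl i₁ hi₁ p hpS x hxB hp1.symm (toLex_lt_iff.2 ⟨i₂, fun j hj => ?_, ?_⟩))
    · rw [hp, Function.update_of_ne (hj.trans h23).ne, Function.update_of_ne hj.ne]
    · rw [hp, Function.update_of_ne h23.ne, Function.update_self, Fin.lt_def]
      simp only; omega
  have ha : (y i₂ : ℕ) = 0 := by
    by_contra hcon
    set q := Function.update (Function.update y i₂ ⟨0, hpos i₂⟩) i₃
      ⟨k i₃ - 1, by have := hpos i₃; omega⟩ with hq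
    set p := Function.update x i₃ ⟨k i₃ - 1, by have := hpos i₃; omega⟩ with hp
    have hqB : q ∈ box I z := update_mem_box (update_mem_box hyB hi₂ _) hi₃ _
    have hq1 : q i₁ = y i₁ := by
      rw [hq, Function.update_of_ne h13.ne, Function.update_of_ne h12.ne]
    have hqS' : q ∈ S := by
      refine hsl i₁ hi₁ y hy q hqB hq1 (toLex_lt_iff.2 ⟨i₂, fun j hj => ?_, ?_⟩)
      · rw [hq, Function.update_of_ne (hj.trans h23).ne, Function.update_of_ne hj.ne]
      · rw [hq, Function.update_of_ne h23.ne, Function.update_self, Fin.lt_def]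
        simp only; omega
    have hpS : p ∈ S := by
      refine hsl i₃ hi₃ q hqS' p (update_mem_box hxB hi₃ _) (by simp [hp, hq])
        (hlex _ _ (fun j hj => ?_) (fun j hj => ?_) ?_)
      · rw [hp, Function.update_of_ne (hj.trans h13).ne]
      · rw [hq, Function.update_of_ne (hj.trans h13).ne, Function.update_of_ne (hj.trans h12).ne]
      · rwa [hq1, hp, Function.update_of_ne h13.ne]
    have := hcl i₃ hi₃ p hpS (x i₃) (by
      rw [hp, Function.update_self, Fin.le_def]; have := (x i₃).2; simp only; omega)
    rw [hp, Function.update_idem, Function.update_eq_self] at this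
    exact hxS this
  have hc : (y i₁ : ℕ) ≤ x i₁ + 1 := by
    by_contra hcon
    set p := Function.update (Function.update x i₁ ⟨x i₁ + 1, by have := (y i₁).2; omega⟩) i₃
      ⟨0, hpos i₃⟩ with hp
    have hpB : p ∈ box I z := update_mem_box (update_mem_box hxB hi₁ _) hi₃ _
    have hp1 : (p i₁ : ℕ) = x i₁ + 1 := by
      rw [hp, Function.update_of_ne h13.ne, Function.update_self]
    have hpre' : ∀ j, j < i₁ → p j = x j := fun j hj => by
      rw [hp, Function.update_of_ne (hj.trans h13).ne, Function.update_of_ne hj.ne]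
    have hpS : p ∈ S := by
      refine hsl i₃ hi₃ _ hqS p hpB (by simp [hp]) (hlex _ _ hpre' (fun j hj => ?_) ?_)
      · rw [Function.update_of_ne (hj.trans h13).ne]
      · rw [Function.update_of_ne h13.ne, Fin.lt_def]; omega
    refine hxS (hsl i₂ hi₂ p hpS x hxB ?_ (toLex_lt_iff.2 ⟨i₁, fun j hj => (hpre' j hj).symm, ?_⟩))
    · rw [hp, Function.update_of_ne h23.ne, Function.update_of_ne h12.ne']
    · rw [Fin.lt_def]; omega
  have hxe : x ∉ S.erase y := fun h => hxS (Finset.mem_of_mem_erase h)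
  -- Closedness survives: all box points before the first missing one are in `S`, and `y`, being
  -- last, is not obtained by lowering another point.
  have hcl' : CoordClosed I (insert x (S.erase y)) := by
    intro i hi u hu t ht
    rcases ht.eq_or_lt with rfl | ht
    · rwa [Function.update_eq_self]
    have hult := toLex_update_self_lt ht
    rcases Finset.mem_insert.1 hu with rfl | hu
    · refine Finset.mem_insert_of_mem (Finset.mem_erase.2 ⟨?_, ?_⟩)
      · rintro rfl
        exact lt_asymm hult hxy
      · by_contra hcon
        exact absurd (hxmin _ (Finset.mem_sdiff.2 ⟨update_mem_box hxB hi t, hcon⟩))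
          (not_le.2 hult)
    · rw [Finset.mem_erase] at hu
      refine Finset.mem_insert_of_mem (Finset.mem_erase.2 ⟨?_, hcl i hi u hu.2 t ht.le⟩)
      rintro rfl
      exact absurd (hymax u hu.2) (not_le.2 hult)
  refine ⟨insert x (S.erase y), ?_, ?_, ?_, ?_⟩
  · exact Finset.insert_subset hxB ((Finset.erase_subset _ _).trans hS)
  · rw [Finset.card_insert_of_notMem hxe, Finset.card_erase_add_one hy]
  · rw [weightedCut_eq_of_closed w hcl', weightedCut_eq_of_closed w hcl,
      Finset.sum_insert hxe, ← Finset.add_sum_erase S _ hy]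
    -- Coordinate `i₁` loses one unit of weight `w i₁`; coordinate `i₂` gains `k i₂ - 1 ≥ 1` units
    -- of weight `w i₂ ≥ w i₁`; the others do not decrease.
    refine add_le_add_left ?_ _
    rw [← Finset.add_sum_erase I _ hi₁, ← Finset.add_sum_erase I _ hi₁,
      ← Finset.add_sum_erase _ _ (Finset.mem_erase.2 ⟨h12.ne', hi₂⟩),
      ← Finset.add_sum_erase _ _ (Finset.mem_erase.2 ⟨h12.ne', hi₂⟩)]
    have hrest : ∑ i ∈ (I.erase i₁).erase i₂, w i * ((k i : ℚ) - 1 - 2 * (x i : ℕ)) ≤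
        ∑ i ∈ (I.erase i₁).erase i₂, w i * ((k i : ℚ) - 1 - 2 * (y i : ℕ)) := by
      refine Finset.sum_le_sum fun i hi => mul_le_mul_of_nonneg_left ?_ (hw0 i)
      rw [Finset.mem_erase, Finset.mem_erase] at hi
      have : ((y i : ℕ) : ℚ) ≤ (x i : ℕ) := by exact_mod_cast (hd i hi.2.2 hi.2.1).le
      linarith
    have e1 : ((y i₁ : ℕ) : ℚ) ≤ (x i₁ : ℕ) + 1 := by exact_mod_cast hc
    have e2 : ((x i₂ : ℕ) : ℚ) = k i₂ - 1 := by
      have : ((x i₂ : ℕ) : ℚ) + 1 = k i₂ := by exact_mod_cast hb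
      linarith
    have e3 : (2 : ℚ) ≤ k i₂ := by exact_mod_cast hk i₂
    have e4 := mul_le_mul_of_nonneg_left e1 (hw0 i₁)
    have e5 := mul_le_mul_of_nonneg_left e3 (hw0 i₂)
    have e6 := hmono i₁ i₂ h12
    rw [e2, ha]
    push_cast
    linarith
  · rw [Finset.sum_insert hxe, ← Finset.add_sum_erase S _ hy]
    exact Nat.add_lt_add_right (lexRank_lt hxy) _

/-- Initial segments of the lexicographic order minimize the weighted cut. -/
theorem LexInitial.weightedCut_le {w : Fin d → ℚ} (hw0 : ∀ i, 0 ≤ w i)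
    (hmono : ∀ i j, i < j → w i ≤ w j) (hk : ∀ i, 2 ≤ k i)
    (hw : ∀ i j, i < j → k i ≤ k j ∨ w i * ((k i : ℚ) ^ 2 - 1) ≤ w j * (k j : ℚ) ^ 2)
    (I : Finset (Fin d)) (z : ∀ i, Fin (k i)) {T S : Finset (∀ i, Fin (k i))}
    (hT : LexInitial (box I z) T) (hS : S ⊆ box I z) (hcard : S.card = T.card) :
    weightedCut w I T ≤ weightedCut w I S := by
  induction hn : I.card using Nat.strong_induction_on generalizing I z T S with
  | _ n ih =>
  induction hr : ∑ x ∈ S, lexRank x using Nat.strong_induction_on generalizing S with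
  | _ r ihr =>
  by_cases hST : S = T
  · rw [hST]
  rcases Nat.lt_or_ge n 2 with hn2 | hn2
  · interval_cases n
    · rw [Finset.card_eq_zero.1 hn]; simp [weightedCut]
    · obtain ⟨i, rfl⟩ := Finset.card_eq_one.1 hn
      rw [weightedCut_singleton hT.1, weightedCut_singleton hS, hcard]
  have step : (∃ S' ⊆ box I z, S'.card = S.card ∧ weightedCut w I S' ≤ weightedCut w I S ∧
      ∑ x ∈ S', lexRank x < ∑ x ∈ S, lexRank x) → weightedCut w I T ≤ weightedCut w I S := by
    rintro ⟨S', hS', hc, hle, hlt⟩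
    exact (ihr _ (hr ▸ hlt) hS' (hc.trans hcard) rfl).trans hle
  by_cases hall : ∀ i ∈ I, ∀ t, LexInitial (box (I.erase i) (Function.update z i t)) (slice i t S)
  swap
  · push Not at hall
    obtain ⟨i, hi, hne⟩ := hall
    refine step (exists_compression hw0 hi (fun t T S hT hS hc => ?_) hS (by push Not; exact hne))
    exact ih (I.erase i).card (by rw [Finset.card_erase_of_mem hi]; omega) _ _ hT hS hc rfl
  have hsl : ∀ i ∈ I, ∀ x ∈ S, ∀ y ∈ box I z, y i = x i → toLex y < toLex x → y ∈ S := by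
    intro i hi x hx y hy hyx hlt
    exact (mem_slice.1 ((hall i hi (x i)).2 x (mem_slice.2 ⟨hx, rfl⟩) y
      ((mem_box_erase hi).2 ⟨hy, hyx⟩) hlt)).1
  have hcl : CoordClosed I S := by
    intro i hi x hx t ht
    rcases ht.eq_or_lt with rfl | ht
    · rwa [Function.update_eq_self]
    -- Lowering coordinate `i` stays inside a slice of any other direction `j`.
    obtain ⟨j, hj, hji⟩ := Finset.exists_mem_ne (by omega : 1 < I.card) i
    exact hsl j hj x hx _ (update_mem_box (hS hx) hi t) (Function.update_of_ne hji _ _)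
      (toLex_update_self_lt ht)
  rcases hn2.eq_or_lt with rfl | hn3
  · obtain ⟨a, b, hab, rfl⟩ := Finset.card_eq_two.1 hn
    rcases lt_or_gt_of_ne hab with h | h
    · exact weightedCut_pair_le h (hw0 a) (hmono a b h) (hw a b h) hT hS hcl hcard
    · rw [Finset.pair_comm] at hT hS hcl ⊢
      exact weightedCut_pair_le h (hw0 b) (hmono b a h) (hw b a h) hT hS hcl hcard
  · exact step (exists_improving_swap hw0 hmono hk (by omega) hS hsl hcl
      fun h => hST (h.eq_of_card_eq hT hcard))

end LexOptimal

/-! ### Cuts of rings -/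

section Cycle

theorem cutSize_eq_sum {V : Type*} [Fintype V] [DecidableEq V] (G : SimpleGraph V)
    [DecidableRel G.Adj] (S : Finset V) :
    cutSize G S = ∑ x ∈ S, (Finset.univ.filter fun y => G.Adj x y ∧ y ∉ S).card := by
  classical
  have : cutSize G S = ((S ×ˢ Sᶜ).filter fun p => G.Adj p.1 p.2).card := by
    unfold cutSize SimpleGraph.interedges Rel.interedges
    congr!
  rw [this, Finset.card_filter, Finset.sum_product]
  refine Finset.sum_congr rfl fun x _ => ?_
  rw [← Finset.card_filter]
  congr 1
  ext y
  simp [and_comm]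

theorem cycleGraph_adj_val {n : ℕ} {s t : Fin n} (hn : 2 ≤ n) :
    (SimpleGraph.cycleGraph n).Adj s t ↔ (s : ℕ) + 1 = t ∨ (t : ℕ) + 1 = s ∨
      ((s : ℕ) = 0 ∧ (t : ℕ) + 1 = n) ∨ ((t : ℕ) = 0 ∧ (s : ℕ) + 1 = n) := by
  have h : ∀ u v : Fin n, (u - v).val = 1 ↔ (v : ℕ) + 1 = u ∨ ((u : ℕ) = 0 ∧ (v : ℕ) + 1 = n) := by
    intro u v
    have hu := u.2
    have hv := v.2
    rw [Fin.sub_def]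
    simp only
    rcases lt_or_ge (u : ℕ) v with h | h
    · rw [Nat.mod_eq_of_lt (by omega)]; omega
    · rw [show n - (v : ℕ) + u = u - v + n by omega, Nat.add_mod_right,
        Nat.mod_eq_of_lt (by omega)]
      omega
  rw [SimpleGraph.cycleGraph_adj', h, h]
  omega

theorem exists_mem_add_one_notMem {n : ℕ} [NeZero n] {A : Finset (Fin n)} (hA : A.Nonempty)
    (hA' : A ≠ Finset.univ) (e : Fin n) (he : ∀ b, ∃ m : ℕ, b = m • e) :
    ∃ s ∈ A, s + e ∉ A := by
  by_contra hcon
  push Not at hcon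
  obtain ⟨a, ha⟩ := hA
  refine hA' (Finset.eq_univ_of_forall fun b => ?_)
  have : ∀ m : ℕ, a + m • e ∈ A := fun m => by
    induction m with
    | zero => simpa using ha
    | succ m ih => rw [succ_nsmul, ← add_assoc]; exact hcon _ ih
  obtain ⟨m, hm⟩ := he (b - a)
  have := this m
  rwa [← hm, add_sub_cancel] at this

theorem Fin.val_nsmul_one {m : ℕ} (b : Fin (m + 2)) : (b : ℕ) • (1 : Fin (m + 2)) = b := by
  obtain ⟨l, hl⟩ := b
  induction l with
  | zero => simp
  | succ l ih =>
    have := ih (by omega)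
    simp only at this ⊢
    rw [succ_nsmul, this]
    ext
    rw [Fin.val_add, Fin.val_one, Nat.mod_eq_of_lt hl]

theorem two_le_cutSize_cycleGraph {n : ℕ} (hn : 3 ≤ n) {A : Finset (Fin n)} (hA : A.Nonempty)
    (hA' : A ≠ Finset.univ) : 2 ≤ cutSize (SimpleGraph.cycleGraph n) A := by
  classical
  obtain ⟨m, rfl⟩ : ∃ m, n = m + 3 := ⟨n - 3, by omega⟩
  have he : ∀ b : Fin (m + 3), ∃ l : ℕ, b = l • (1 : Fin (m + 3)) := fun b =>
    ⟨b, (Fin.val_nsmul_one b).symm⟩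
  have he' : ∀ b : Fin (m + 3), ∃ l : ℕ, b = l • (-1 : Fin (m + 3)) := fun b =>
    ⟨((-b : Fin (m + 3)) : ℕ), by rw [smul_neg, Fin.val_nsmul_one, neg_neg]⟩
  obtain ⟨s, hs, hs1⟩ := exists_mem_add_one_notMem hA hA' 1 he
  obtain ⟨t, ht, ht1⟩ := exists_mem_add_one_notMem hA hA' (-1) he'
  rw [cutSize_eq_sum, ← Finset.card_sigma]
  -- The exits in the two directions are different edges because `1 ≠ -1` modulo `m + 3`.
  have hne : (⟨s, s + 1⟩ : (_ : Fin (m + 3)) × Fin (m + 3)) ≠ ⟨t, t + -1⟩ := by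
    intro h
    simp only [Sigma.mk.injEq, heq_eq_eq] at h
    obtain ⟨rfl, h⟩ := h
    have h := add_left_cancel h
    have := congrArg Fin.val h
    simp [Fin.neg_def] at this
  rw [← Finset.card_pair hne]
  refine Finset.card_le_card fun p hp => ?_
  rw [Finset.mem_insert, Finset.mem_singleton] at hp
  rcases hp with rfl | rfl
  · simp [hs, hs1, SimpleGraph.cycleGraph_adj (n := m + 1)]
  · simp [ht, ht1, SimpleGraph.cycleGraph_adj (n := m + 1)]

theorem cutSize_cycleGraph_initial {n a : ℕ} (hn : 3 ≤ n) (ha : 0 < a) (han : a < n) :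
    cutSize (SimpleGraph.cycleGraph n) (Finset.univ.filter fun t : Fin n => (t : ℕ) < a) = 2 := by
  classical
  rw [cutSize_eq_sum, ← Finset.card_sigma]
  have hne : (⟨⟨a - 1, by omega⟩, ⟨a, han⟩⟩ : (_ : Fin n) × Fin n) ≠
      ⟨⟨0, by omega⟩, ⟨n - 1, by omega⟩⟩ := by
    intro h
    simp only [Sigma.mk.injEq, heq_eq_eq, Fin.mk.injEq] at h
    omega
  rw [← Finset.card_pair hne]
  congr 1
  ext ⟨s, t⟩
  have hs := s.2
  have ht := t.2
  simp only [Finset.mem_sigma, Finset.mem_filter, Finset.mem_univ, true_and, Finset.mem_insert,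
    Finset.mem_singleton, Sigma.mk.injEq, heq_eq_eq, Fin.ext_iff, cycleGraph_adj_val (show 2 ≤ n by omega)]
  omega

theorem cutSize_empty {V : Type*} [Fintype V] (G : SimpleGraph V) : cutSize G ∅ = 0 := by
  classical
  rw [cutSize_eq_sum]; simp

theorem cutSize_univ {V : Type*} [Fintype V] (G : SimpleGraph V) : cutSize G Finset.univ = 0 := by
  classical
  rw [cutSize_eq_sum]; simp

end Cycle

/-! ### The torus cut against the weighted cut -/

section Torus

variable {d : ℕ} {k : Fin d → ℕ}

/-- The set of the values `s` for which replacing coordinate `i` of `x` by `s` gives a point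
of `S`. -/
def fibre (i : Fin d) (S : Finset (∀ i, Fin (k i))) (x : ∀ i, Fin (k i)) : Finset (Fin (k i)) :=
  Finset.univ.filter fun s => Function.update x i s ∈ S

theorem mem_fibre {i : Fin d} {S : Finset (∀ i, Fin (k i))} {x : ∀ i, Fin (k i)} {s : Fin (k i)} :
    s ∈ fibre i S x ↔ Function.update x i s ∈ S := by simp [fibre]

/-- Letting `x` run over all points meets each line in direction `i` exactly `k i` times, so no
representatives of lines are needed. The involution exchanges the new value with the old one. -/
theorem sum_sum_update (i : Fin d) (F : (∀ i, Fin (k i)) → ℕ) :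
    ∑ x, ∑ s, F (Function.update x i s) = k i * ∑ x, F x := by
  have h : Function.Involutive (fun p : (∀ i, Fin (k i)) × Fin (k i) =>
      (Function.update p.1 i p.2, p.1 i)) := fun p => by simp
  have := Equiv.sum_comp h.toPerm (fun p => F p.1)
  simp only [Function.Involutive.coe_toPerm, Fintype.sum_prod_type] at this
  rw [this, Finset.mul_sum]
  simp

theorem sum_fibre (i : Fin d) (S : Finset (∀ i, Fin (k i))) (F : (∀ i, Fin (k i)) → ℕ) :
    ∑ x, ∑ s ∈ fibre i S x, F (Function.update x i s) = k i * ∑ x ∈ S, F x := by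
  have := sum_sum_update i fun x => if x ∈ S then F x else 0
  rw [← Finset.sum_filter, Finset.filter_mem_eq_inter, Finset.univ_inter] at this
  rw [← this]
  refine Finset.sum_congr rfl fun x _ => ?_
  rw [fibre, Finset.sum_filter]

theorem mul_cutDir (i : Fin d) (S : Finset (∀ i, Fin (k i))) :
    k i * cutDir i S = ∑ x, (fibre i S x).card * (k i - (fibre i S x).card) := by
  rw [cutDir, ← sum_fibre]
  refine Finset.sum_congr rfl fun x _ => ?_
  rw [← smul_eq_mul, ← Finset.sum_const]
  refine Finset.sum_congr rfl fun s _ => ?_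
  have : (Finset.univ.filter fun t => Function.update (Function.update x i s) i t ∉ S) =
      (fibre i S x)ᶜ := by
    ext t; simp [mem_fibre]
  rw [this, Finset.card_compl, Fintype.card_fin]

open Classical in
/-- The number of edges of the torus in direction `i` that leave `S`. -/
noncomputable def edgeCutDir (i : Fin d) (S : Finset (∀ i, Fin (k i))) : ℕ :=
  ∑ x ∈ S, (Finset.univ.filter fun t =>
    (SimpleGraph.cycleGraph (k i)).Adj (x i) t ∧ Function.update x i t ∉ S).card

theorem mul_edgeCutDir (i : Fin d) (S : Finset (∀ i, Fin (k i))) :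
    k i * edgeCutDir i S = ∑ x, cutSize (SimpleGraph.cycleGraph (k i)) (fibre i S x) := by
  classical
  rw [edgeCutDir, ← sum_fibre]
  refine Finset.sum_congr rfl fun x _ => ?_
  rw [cutSize_eq_sum]
  refine Finset.sum_congr rfl fun s _ => congrArg Finset.card ?_
  ext t
  simp [mem_fibre]

theorem cutSize_torus (S : Finset (∀ i, Fin (k i))) :
    cutSize (torus k) S = ∑ i, edgeCutDir i S := by
  classical
  rw [cutSize_eq_sum]
  simp only [edgeCutDir]
  rw [Finset.sum_comm]
  refine Finset.sum_congr rfl fun x _ => ?_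
  rw [← Finset.card_sigma]
  symm
  refine Finset.card_bij (fun p _ => Function.update x p.1 p.2) ?_ ?_ ?_
  · rintro ⟨i, t⟩ hp
    simp only [Finset.mem_sigma, Finset.mem_filter, Finset.mem_univ, true_and] at hp ⊢
    refine ⟨⟨i, by simpa using hp.1, fun j hj => (Function.update_of_ne hj _ _).symm⟩, hp.2⟩
  · rintro ⟨i, t⟩ hp ⟨j, s⟩ hq h
    simp only [Finset.mem_sigma, Finset.mem_filter, Finset.mem_univ, true_and] at hp hq h
    obtain rfl : i = j := by
      by_contra hij
      have := congrFun h i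
      rw [Function.update_self, Function.update_of_ne hij] at this
      exact hp.1.ne this.symm
    have := congrFun h i
    simp only [Function.update_self] at this
    rw [this]
  · intro y hy
    simp only [Finset.mem_filter, Finset.mem_univ, true_and] at hy
    obtain ⟨⟨i, hadj, hoff⟩, hyS⟩ := hy
    have : Function.update x i (y i) = y := by
      funext j
      rcases eq_or_ne j i with rfl | hj
      · simp
      · rw [Function.update_of_ne hj, hoff j hj]
    exact ⟨⟨i, y i⟩, by simpa [this] using ⟨hadj, hyS⟩, this⟩

/-- The reciprocal of the largest cut of a set of `k i` points. -/
def balancedWeight (k : Fin d → ℕ) (i : Fin d) : ℚ := 1 / ((k i / 2 * (k i - k i / 2) : ℕ) : ℚ)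

theorem half_mul_half_pos {n : ℕ} (hn : 3 ≤ n) : 0 < n / 2 * (n - n / 2) :=
  Nat.mul_pos (by omega) (by omega)

theorem mul_sub_le_half_mul_half {n a : ℕ} (ha : a ≤ n) : a * (n - a) ≤ n / 2 * (n - n / 2) := by
  obtain ⟨b, rfl⟩ := Nat.exists_eq_add_of_le ha
  obtain ⟨c, hc | hc⟩ := Nat.even_or_odd' (a + b)
  · rw [hc, Nat.mul_div_cancel_left _ two_pos, show 2 * c - c = c by omega]
    obtain rfl : b = 2 * c - a := by omega
    zify [show a ≤ 2 * c by omega]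
    nlinarith [sq_nonneg ((a : ℤ) - c)]
  · rw [hc, show (2 * c + 1) / 2 = c by omega, show 2 * c + 1 - c = c + 1 by omega]
    rcases le_or_gt a c with h | h
    · obtain ⟨e, rfl⟩ := Nat.exists_eq_add_of_le h
      rw [show 2 * (a + e) + 1 - a = a + 2 * e + 1 by omega]; nlinarith
    · obtain ⟨e, rfl⟩ := Nat.exists_eq_add_of_lt h
      rw [show 2 * c + 1 - (c + e + 1) = c - e by omega]
      zify [show e ≤ c by omega]
      nlinarith

theorem four_mul_half_mul_half_le (n : ℕ) : 4 * (n / 2 * (n - n / 2)) ≤ n ^ 2 := by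
  obtain ⟨c, rfl | rfl⟩ := Nat.even_or_odd' n
  · rw [show 2 * c / 2 = c by omega, show 2 * c - c = c by omega]; nlinarith
  · rw [show (2 * c + 1) / 2 = c by omega, show 2 * c + 1 - c = c + 1 by omega]; nlinarith

theorem sq_le_four_mul_half_mul_half (n : ℕ) : n ^ 2 ≤ 4 * (n / 2 * (n - n / 2)) + 1 := by
  obtain ⟨c, rfl | rfl⟩ := Nat.even_or_odd' n
  · rw [show 2 * c / 2 = c by omega, show 2 * c - c = c by omega]; nlinarith
  · rw [show (2 * c + 1) / 2 = c by omega, show 2 * c + 1 - c = c + 1 by omega]; nlinarith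

theorem balancedWeight_mono (hk : ∀ i, 3 ≤ k i) (hanti : Antitone k) {i j : Fin d} (h : i < j) :
    balancedWeight k i ≤ balancedWeight k j := by
  have := half_mul_half_pos (hk j)
  have h1 := hanti h.le
  refine one_div_le_one_div_of_le (by exact_mod_cast this) ?_
  exact_mod_cast Nat.mul_le_mul (by omega) (by omega)

/-- The number 4 separates the two sides, since `n² - 1 ≤ 4 ⌊n/2⌋ ⌈n/2⌉ ≤ n²`. -/
theorem balancedWeight_mul_le (hk : ∀ i, 3 ≤ k i) (i j : Fin d) :
    balancedWeight k i * ((k i : ℚ) ^ 2 - 1) ≤ balancedWeight k j * (k j : ℚ) ^ 2 := by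
  have hi : (0 : ℚ) < (k i / 2 * (k i - k i / 2) : ℕ) := by
    exact_mod_cast half_mul_half_pos (hk i)
  have hj : (0 : ℚ) < (k j / 2 * (k j - k j / 2) : ℕ) := by
    exact_mod_cast half_mul_half_pos (hk j)
  calc balancedWeight k i * ((k i : ℚ) ^ 2 - 1) ≤ 4 := by
        rw [balancedWeight, one_div_mul_eq_div, div_le_iff₀ hi]
        have : ((k i : ℚ)) ^ 2 ≤ 4 * (k i / 2 * (k i - k i / 2) : ℕ) + 1 := by
          exact_mod_cast sq_le_four_mul_half_mul_half (k i)
        linarith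
    _ ≤ _ := by
        rw [balancedWeight, one_div_mul_eq_div, le_div_iff₀ hj]
        exact_mod_cast four_mul_half_mul_half_le (k j)

theorem two_mul_balancedWeight_le {i : Fin d} (hk : 3 ≤ k i) (A : Finset (Fin (k i))) :
    2 * balancedWeight k i * (A.card * (k i - A.card) : ℕ) ≤
      cutSize (SimpleGraph.cycleGraph (k i)) A := by
  rcases A.eq_empty_or_nonempty with rfl | hne
  · simp
  by_cases hu : A = Finset.univ
  · simp [hu]
  have h2 : (2 : ℚ) ≤ cutSize (SimpleGraph.cycleGraph (k i)) A := by
    exact_mod_cast two_le_cutSize_cycleGraph hk hne hu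
  have hi : (0 : ℚ) < (k i / 2 * (k i - k i / 2) : ℕ) := by exact_mod_cast half_mul_half_pos hk
  have hA : ((A.card * (k i - A.card) : ℕ) : ℚ) ≤ (k i / 2 * (k i - k i / 2) : ℕ) := by
    exact_mod_cast mul_sub_le_half_mul_half (by simpa using A.card_le_univ)
  refine le_trans ?_ h2
  rw [balancedWeight, mul_assoc, one_div_mul_eq_div]
  have := (div_le_one hi).2 hA
  linarith

theorem two_mul_weightedCut_le (hk : ∀ i, 3 ≤ k i) (S : Finset (∀ i, Fin (k i))) :
    2 * weightedCut (balancedWeight k) Finset.univ S ≤ cutSize (torus k) S := by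
  rw [cutSize_torus, weightedCut, Finset.mul_sum, Nat.cast_sum]
  refine Finset.sum_le_sum fun i _ => ?_
  have hki : (0 : ℚ) < k i := by have := hk i; exact_mod_cast (by omega : 0 < k i)
  refine le_of_mul_le_mul_left ?_ hki
  rw [show (k i : ℚ) * (2 * (balancedWeight k i * cutDir i S)) =
    2 * balancedWeight k i * ((k i * cutDir i S : ℕ) : ℚ) by push_cast; ring, ← Nat.cast_mul,
    mul_cutDir, mul_edgeCutDir, Nat.cast_sum, Nat.cast_sum, Finset.mul_sum]
  exact Finset.sum_le_sum fun x _ => two_mul_balancedWeight_le (hk i) _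

end Torus

/-! ### The optimal half and its cut -/

section HalfSet

variable {d : ℕ} {k : Fin d → ℕ}

/-- The reflection of a point in the centre of the grid. -/
def reflect (x : ∀ i, Fin (k i)) : ∀ i, Fin (k i) := fun i => (x i).rev

theorem reflect_reflect (x : ∀ i, Fin (k i)) : reflect (reflect x) = x := by
  funext i; simp [reflect]

theorem toLex_reflect_lt {x y : ∀ i, Fin (k i)} (h : toLex x < toLex y) :
    toLex (reflect y) < toLex (reflect x) := by
  obtain ⟨i, hi, hlt⟩ := toLex_lt_iff.1 h
  exact toLex_lt_iff.2 ⟨i, fun j hj => by simp [reflect, hi j hj], Fin.rev_lt_rev.2 hlt⟩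

open Classical in
/-- The points that precede their reflection in the lexicographic order. -/
noncomputable def lexHalf (k : Fin d → ℕ) : Finset (∀ i, Fin (k i)) :=
  Finset.univ.filter fun x => toLex x < toLex (reflect x)

theorem mem_lexHalf {x : ∀ i, Fin (k i)} : x ∈ lexHalf k ↔ toLex x < toLex (reflect x) := by
  simp [lexHalf]

theorem lexInitial_lexHalf (z : ∀ i, Fin (k i)) :
    LexInitial (box Finset.univ z) (lexHalf k) :=
  ⟨fun _ _ => mem_box.2 fun i hi => absurd (Finset.mem_univ i) hi, fun _ hx _ _ hyx =>
    mem_lexHalf.2 (hyx.trans ((mem_lexHalf.1 hx).trans (toLex_reflect_lt hyx)))⟩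

/-- Reflection exchanges `lexHalf` with the points after their reflection, and it fixes at most one
point. -/
theorem card_lexHalf : (lexHalf k).card = Fintype.card (∀ i, Fin (k i)) / 2 := by
  classical
  have h1 : (Finset.univ.filter fun x : ∀ i, Fin (k i) => toLex (reflect x) < toLex x).card =
      (lexHalf k).card := by
    refine Finset.card_bij' (fun x _ => reflect x) (fun x _ => reflect x) ?_ ?_ ?_ ?_
    · intro x hx
      rw [mem_lexHalf, reflect_reflect]
      simpa using hx
    · intro x hx
      rw [Finset.mem_filter, reflect_reflect]
      exact ⟨Finset.mem_univ _, mem_lexHalf.1 hx⟩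
    · intro x _; exact reflect_reflect x
    · intro x _; exact reflect_reflect x
  have h2 : (Finset.univ.filter fun x : ∀ i, Fin (k i) => reflect x = x).card ≤ 1 := by
    rw [Finset.card_le_one]
    intro x hx y hy
    simp only [Finset.mem_filter, Finset.mem_univ, true_and] at hx hy
    funext i
    have e1 := congrArg Fin.val (congrFun hx i)
    have e2 := congrArg Fin.val (congrFun hy i)
    simp only [reflect, Fin.val_rev] at e1 e2
    ext; omega
  have h3 : Fintype.card (∀ i, Fin (k i)) = (lexHalf k).card +
      ((Finset.univ.filter fun x : ∀ i, Fin (k i) => toLex (reflect x) < toLex x).card +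
        (Finset.univ.filter fun x : ∀ i, Fin (k i) => reflect x = x).card) := by
    rw [← Finset.card_union_of_disjoint, ← Finset.card_union_of_disjoint, ← Finset.card_univ]
    · congr 1
      ext x
      simp only [Finset.mem_univ, Finset.mem_union, mem_lexHalf, Finset.mem_filter, true_and,
        true_iff]
      rcases lt_trichotomy (toLex x) (toLex (reflect x)) with h | h | h
      · exact Or.inl h
      · exact Or.inr (Or.inr (toLex_inj.1 h).symm)
      · exact Or.inr (Or.inl h)
    · rw [Finset.disjoint_left]
      intro x hx hx'
      simp only [Finset.mem_union, mem_lexHalf, Finset.mem_filter, Finset.mem_univ,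
        true_and] at hx hx'
      rcases hx' with h | h
      · exact lt_asymm hx h
      · rw [h] at hx; exact lt_irrefl _ hx
    · rw [Finset.disjoint_left]
      intro x hx hx'
      simp only [Finset.mem_filter, Finset.mem_univ, true_and] at hx hx'
      rw [hx'] at hx; exact lt_irrefl _ hx
  omega

/-- The coordinates of `x` before `i` are in the middle of their range. -/
def CentralBefore (i : Fin d) (x : ∀ i, Fin (k i)) : Prop := ∀ j, j < i → x j = (x j).rev

/-- The comparison with the reflection is decided before coordinate `i`, hence is the same along the
whole line. -/
theorem fibre_lexHalf_of_not_central {i : Fin d} {x : ∀ i, Fin (k i)} (h : ¬ CentralBefore i x) :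
    fibre i (lexHalf k) x = ∅ ∨ fibre i (lexHalf k) x = Finset.univ := by
  rcases (fibre i (lexHalf k) x).eq_empty_or_nonempty with he | ⟨s, hs⟩
  · exact Or.inl he
  right
  refine Finset.eq_univ_of_forall fun t => ?_
  rw [mem_fibre, mem_lexHalf] at hs ⊢
  simp only [CentralBefore, not_forall] at h
  obtain ⟨l, hl, hne⟩ := h
  obtain ⟨m, hm, hlt⟩ := toLex_lt_iff.1 hs
  have hml : m ≤ l := by
    by_contra hcon
    have := hm l (not_le.1 hcon)
    simp only [reflect, Function.update_of_ne hl.ne] at this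
    exact hne this
  have heq : ∀ j, j ≤ m → Function.update x i t j = Function.update x i s j := fun j hj => by
    have : j ≠ i := ((hj.trans hml).trans_lt hl).ne
    rw [Function.update_of_ne this, Function.update_of_ne this]
  refine toLex_lt_iff.2 ⟨m, fun j hj => ?_, ?_⟩
  · have := hm j hj
    simp only [reflect] at this ⊢
    rwa [heq j hj.le]
  · simp only [reflect] at hlt ⊢
    rwa [heq m le_rfl]

theorem fibre_lexHalf_of_central {i : Fin d} {x : ∀ i, Fin (k i)} (h : CentralBefore i x) :
    ∃ a, (a = k i / 2 ∨ a = k i - k i / 2) ∧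
      fibre i (lexHalf k) x = Finset.univ.filter fun t : Fin (k i) => (t : ℕ) < a := by
  have hin : ∀ t : Fin (k i), 2 * (t : ℕ) + 1 < k i → t ∈ fibre i (lexHalf k) x := fun t ht => by
    rw [mem_fibre, mem_lexHalf]
    refine toLex_lt_iff.2 ⟨i, fun j hj => ?_, ?_⟩
    · simp only [reflect, Function.update_of_ne hj.ne]
      exact h j hj
    · simp only [reflect, Function.update_self, Fin.lt_def, Fin.val_rev]; omega
  have hout : ∀ t : Fin (k i), k i < 2 * (t : ℕ) + 1 → t ∉ fibre i (lexHalf k) x := fun t ht hmem => by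
    rw [mem_fibre, mem_lexHalf] at hmem
    obtain ⟨m, hm, hlt⟩ := toLex_lt_iff.1 hmem
    simp only [reflect] at hm hlt
    rcases lt_trichotomy m i with hmi | rfl | hmi
    · rw [Function.update_of_ne hmi.ne, ← h m hmi] at hlt
      exact lt_irrefl _ hlt
    · rw [Function.update_self, Fin.lt_def, Fin.val_rev] at hlt; omega
    · have := congrArg Fin.val (hm i hmi)
      rw [Function.update_self, Fin.val_rev] at this; omega
  -- Only the middle value, present for odd `k i`, leaves the decision to later coordinates; it
  -- determines whether the length is rounded up or down.
  by_cases hmid : ∃ s : Fin (k i), 2 * (s : ℕ) + 1 = k i ∧ s ∈ fibre i (lexHalf k) x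
  · obtain ⟨s, hs, hsm⟩ := hmid
    refine ⟨k i - k i / 2, Or.inr rfl, ?_⟩
    ext t
    simp only [Finset.mem_filter, Finset.mem_univ, true_and]
    rcases lt_trichotomy (t : ℕ) s with hts | hts | hts
    · exact iff_of_true (hin t (by omega)) (by omega)
    · exact iff_of_true (Fin.ext hts ▸ hsm) (by omega)
    · exact iff_of_false (hout t (by omega)) (by omega)
  · refine ⟨k i / 2, Or.inl rfl, ?_⟩
    ext t
    simp only [Finset.mem_filter, Finset.mem_univ, true_and]
    rcases lt_trichotomy (2 * (t : ℕ) + 1) (k i) with ht | ht | ht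
    · exact iff_of_true (hin t ht) (by omega)
    · exact iff_of_false (fun hm => hmid ⟨t, ht, hm⟩) (by omega)
    · exact iff_of_false (hout t ht) (by omega)

open Classical in
theorem cutSize_fibre_lexHalf {i : Fin d} (hk : 3 ≤ k i) (x : ∀ i, Fin (k i)) :
    cutSize (SimpleGraph.cycleGraph (k i)) (fibre i (lexHalf k) x) =
      if CentralBefore i x then 2 else 0 := by
  split_ifs with h
  · obtain ⟨a, ha, he⟩ := fibre_lexHalf_of_central h
    rw [he]
    rcases ha with rfl | rfl <;> exact cutSize_cycleGraph_initial hk (by omega) (by omega)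
  · rcases fibre_lexHalf_of_not_central h with he | he <;> rw [he]
    · exact cutSize_empty _
    · exact cutSize_univ _

theorem cutSize_fibre_lexHalf_eq {i : Fin d} (hk : 3 ≤ k i) (x : ∀ i, Fin (k i)) :
    (cutSize (SimpleGraph.cycleGraph (k i)) (fibre i (lexHalf k) x) : ℚ) =
      2 * balancedWeight k i *
        ((fibre i (lexHalf k) x).card * (k i - (fibre i (lexHalf k) x).card) : ℕ) := by
  by_cases h : CentralBefore i x
  · rw [cutSize_fibre_lexHalf hk, if_pos h]
    obtain ⟨a, ha, he⟩ := fibre_lexHalf_of_central h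
    have hcard : (fibre i (lexHalf k) x).card = a := by
      have hak : a < k i := by omega
      have : (Finset.univ.filter fun t : Fin (k i) => (t : ℕ) < a) = Finset.Iio ⟨a, hak⟩ := by
        ext t; simp [Fin.lt_def]
      rw [he, this, Fin.card_Iio]
    have hprod : a * (k i - a) = k i / 2 * (k i - k i / 2) := by
      rcases ha with rfl | rfl
      · rfl
      · rw [mul_comm]; congr 1; omega
    have hi : ((k i / 2 * (k i - k i / 2) : ℕ) : ℚ) ≠ 0 := by
      exact_mod_cast (half_mul_half_pos hk).ne'
    rw [hcard, hprod, balancedWeight, mul_assoc, one_div_mul_cancel hi]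
    norm_num
  · rcases fibre_lexHalf_of_not_central h with he | he <;> rw [he]
    · simp [cutSize_empty]
    · simp [cutSize_univ]

theorem cutSize_lexHalf (hk : ∀ i, 3 ≤ k i) :
    (cutSize (torus k) (lexHalf k) : ℚ) =
      2 * weightedCut (balancedWeight k) Finset.univ (lexHalf k) := by
  rw [cutSize_torus, weightedCut, Finset.mul_sum, Nat.cast_sum]
  refine Finset.sum_congr rfl fun i _ => ?_
  have hki : (k i : ℚ) ≠ 0 := by have := hk i; exact_mod_cast (by omega : k i ≠ 0)
  refine mul_left_cancel₀ hki ?_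
  rw [show (k i : ℚ) * (2 * (balancedWeight k i * cutDir i (lexHalf k))) =
    2 * balancedWeight k i * ((k i * cutDir i (lexHalf k) : ℕ) : ℚ) by push_cast; ring,
    ← Nat.cast_mul, mul_cutDir, mul_edgeCutDir, Nat.cast_sum, Nat.cast_sum, Finset.mul_sum]
  exact Finset.sum_congr rfl fun x _ => cutSize_fibre_lexHalf_eq (hk i) x

theorem cutSize_lexHalf_le (hk : ∀ i, 3 ≤ k i) (hanti : Antitone k)
    {S : Finset (∀ i, Fin (k i))} (hS : S.card = (lexHalf k).card) :
    cutSize (torus k) (lexHalf k) ≤ cutSize (torus k) S := by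
  have z : ∀ i, Fin (k i) := fun i => ⟨0, by have := hk i; omega⟩
  have h := (lexInitial_lexHalf z).weightedCut_le (w := balancedWeight k)
    (fun i => by unfold balancedWeight; positivity)
    (fun i j hij => balancedWeight_mono hk hanti hij) (fun i => by have := hk i; omega)
    (fun i j _ => Or.inr (balancedWeight_mul_le hk i j)) Finset.univ z
    (fun x _ => mem_box.2 fun i hi => absurd (Finset.mem_univ i) hi) hS
  have h2 := two_mul_weightedCut_le hk S
  have h3 := cutSize_lexHalf hk
  have : (cutSize (torus k) (lexHalf k) : ℚ) ≤ cutSize (torus k) S := by linarith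
  exact_mod_cast this

-- Each coordinate before `i` must equal its reversal, which has one solution on an odd side and
-- none on an even one. This is why the final sum stops at the lowest even dimension.
open Classical in
theorem card_centralBefore (i : Fin d) :
    (Finset.univ.filter fun x : ∀ i, Fin (k i) => CentralBefore i x).card =
      if ∀ j, j < i → Odd (k j) then k i * ∏ j ∈ Finset.Ioi i, k j else 0 := by
  have h1 : (Finset.univ.filter fun x : ∀ i, Fin (k i) => CentralBefore i x) =
      Fintype.piFinset fun j => if j < i then Finset.univ.filter fun t : Fin (k j) => t = t.rev
        else Finset.univ := by
    ext x
    rw [Finset.mem_filter, Fintype.mem_piFinset, and_iff_right (Finset.mem_univ _)]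
    refine forall_congr' fun j => ?_
    split_ifs with hj <;> simp [hj]
  have h2 : ∀ n : ℕ, (Finset.univ.filter fun t : Fin n => t = t.rev).card =
      if Odd n then 1 else 0 := by
    intro n
    split_ifs with hn
    · obtain ⟨m, hm⟩ := hn
      rw [Finset.card_eq_one]
      refine ⟨⟨m, by omega⟩, ?_⟩
      ext t
      simp only [Finset.mem_filter, Finset.mem_univ, true_and, Finset.mem_singleton, Fin.ext_iff,
        Fin.val_rev]
      omega
    · rw [Finset.card_eq_zero, Finset.filter_eq_empty_iff]
      intro t _ ht
      have := congrArg Fin.val ht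
      rw [Fin.val_rev] at this
      exact hn ⟨t, by omega⟩
  rw [h1, Fintype.card_piFinset]
  split_ifs with h
  · have : Finset.Ici i = insert i (Finset.Ioi i) := by
      ext j; simp [le_iff_eq_or_lt]
    rw [← Finset.prod_insert (by simp), ← this]
    symm
    rw [← Finset.prod_subset (Finset.subset_univ (Finset.Ici i))]
    · refine Finset.prod_congr rfl fun j hj => ?_
      rw [if_neg (not_lt.2 (Finset.mem_Ici.1 hj))]; simp
    · intro j _ hj
      have hj : j < i := by simpa using hj
      rw [if_pos hj, h2, if_pos (h j hj)]
  · push Not at h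
    obtain ⟨j, hj, hodd⟩ := h
    refine Finset.prod_eq_zero (Finset.mem_univ j) ?_
    rw [if_pos hj, h2, if_neg (by simpa using hodd)]

theorem succ_le_lowestEvenDim_iff (i : Fin d) :
    i.val + 1 ≤ lowestEvenDim k ↔ ∀ j, j < i → Odd (k j) := by
  classical
  unfold lowestEvenDim
  split_ifs with h
  · rw [Nat.add_le_add_iff_right, Nat.le_find_iff]
    constructor
    · intro hm j hj
      have := hm j hj
      simp only [not_exists, Nat.not_even_iff_odd] at this
      exact this j.2
    · rintro hm m hmi ⟨hmd, he⟩
      exact Nat.not_even_iff_odd.2 (hm ⟨m, hmd⟩ hmi) he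
  · refine iff_of_true i.2 fun j _ => ?_
    rw [← Nat.not_even_iff_odd]
    exact fun he => h ⟨j, j.2, he⟩

theorem cutSize_lexHalf_eq (hk : ∀ i, 3 ≤ k i) :
    cutSize (torus k) (lexHalf k) =
      2 * ∑ i ∈ Finset.univ.filter (fun i : Fin d => i.val + 1 ≤ lowestEvenDim k),
        ∏ j ∈ Finset.Ioi i, k j := by
  classical
  rw [cutSize_torus, Finset.mul_sum, Finset.sum_filter]
  refine Finset.sum_congr rfl fun i _ => ?_
  have hki : 0 < k i := by have := hk i; omega
  refine Nat.eq_of_mul_eq_mul_left hki ?_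
  rw [mul_edgeCutDir, Finset.sum_congr rfl fun x _ => cutSize_fibre_lexHalf (hk i) x,
    ← Finset.sum_filter, Finset.sum_const, smul_eq_mul, card_centralBefore]
  simp only [succ_le_lowestEvenDim_iff]
  split_ifs
  · ring
  · simp

end HalfSet

theorem mainTheorem2 {d : ℕ} (k : Fin d → ℕ) (hk : ∀ i, 3 ≤ k i) (hanti : Antitone k) :
    bisectionWidth (torus k) =
      2 * ∑ i ∈ Finset.univ.filter (fun i : Fin d => i.val + 1 ≤ lowestEvenDim k),
        ∏ j ∈ Finset.Ioi i, k j := by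
  rw [← cutSize_lexHalf_eq hk]
  refine le_antisymm (Nat.sInf_le ⟨lexHalf k, card_lexHalf, rfl⟩) ?_
  refine le_csInf ⟨_, lexHalf k, card_lexHalf, rfl⟩ ?_
  rintro _ ⟨S, hS, rfl⟩
  exact cutSize_lexHalf_le hk hanti (hS.trans card_lexHalf.symm)
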